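/- **Notation.** Fix $\tau\in\mathbb{C}$ with $\operatorname{Im}\tau>0$ and write $\mathrm e(z)=e^{2\pi i z}$. Let $$\theta(x;\tau)=\sum_{m\in\mathbb Z}\mathrm e\Bigl(\tfrac12\bigl(m+\tfrac12\bigr)^2\tau+\bigl(m+\tfrac12\bigr)\bigl(x+\tfrac12\bigr)\Bigr),$$ and for $\vec x=(x',x)\in\mathbb R^2\setminus\mathbb Z^2$ let $$\underline F(\vec x;X;\tau)=\mathrm e(xX)\,\frac{\theta'(0;\tau)\,\theta(-x'+x\tau+X;\tau)}{\theta(-x'+x\tau;\tau)\,\theta(X;\tau)},$$ where $\theta'$ is the derivative in $x$. The elliptic Bernoulli functions $B_m(\vec x;\tau)$ $(m\ge 0)$ are defined by the Laurent expansion at $X=0$ $$\underline F(\vec x;X;\tau)=\sum_{m=0}^{\infty}\frac{B_m(\vec x;\tau)}{m!}(2\pi i)^m X^{m-1}.$$ For $r\in\mathbb Q$ let $n(r)\in\mathbb Z$ and $d(r)\in\mathbb Z_{>0}$ be the coprime integers with $r=n(r)/d(r)$. For $m,n\ge 0$ and $M=\begin{pmatrix}\vec x\\ \vec y\end{pmatrix}\in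 \mathrm M_2(\mathbb R)$ with rows $\vec x=(x',x)$, $\vec y=(y',y)$ such that $\vec y,\ n(r)\vec y-d(r)\vec x\notin\mathbb Z^2$, the elliptic Dedekind–Rademacher sum is $$S_{m,n}(r,M;\tau)=\frac1{d(r)}\sum_{\vec\jmath\in(\mathbb Z/d(r)\mathbb Z)^2}B_m\Bigl(\frac{\vec\jmath+\vec y}{d(r)};\tau\Bigr)B_n\Bigl(n(r)\frac{\vec\jmath+\vec y}{d(r)}-\vec x;\tau\Bigr).$$ For $V=\begin{pmatrix}a&b\\c&d\end{pmatrix}\in\mathrm{SL}_2(\mathbb Z)$ put $j(V;z)=cz+d$, $Vz=(az+b)/(cz+d)$, and $$\mathrm M_2(V)=\Bigl\{\begin{pmatrix}\vec x\\ \vec y\end{pmatrix}\in\mathrm M_2(\mathbb R)\ \Big|\ \vec y,\ c\vec x+d\vec y\notin\mathbb Z^2\Bigr\},\qquad \mathrm M_2(r)=\Bigl\{\begin{pmatrix}\vec x\\ \vec y\end{pmatrix}\in\mathrm M_2(\mathbb R)\ \Big|\ \vec y,\ d(r)\vec x-n(r)\vec y\notin\mathbb Z^2\Bigr\}.$$ For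 an integer $l\geq 1$, $M\in \mathrm M_2(V)$ and $z\in\mathbb{C}$ with $j(V;z)\ne 0$ set $$R_V(l,z,M;\tau)=\begin{cases}\displaystyle\frac{(2\pi i)^{l+1}}{(l+1)!}\sum_{k=-1}^{l}\binom{l+1}{k+1}(-j(V;z))^k\,S_{k+1,l-k}\Bigl(\frac dc,\begin{pmatrix}-\vec x\\ \vec y\end{pmatrix};\tau\Bigr)&(c>0),\\[2mm] 0&(c=0),\\ R_{-V}(l,z,M;\tau)&(c<0).\end{cases}$$ **Theorem.** (i) If $V\in\mathrm{SL}_2(\mathbb Z)$ and $c\neq0$, then $\mathrm M_2(-d/c)=\mathrm M_2(V)$. (ii) Let $r\in\mathbb Q$, let $l$ be a positive integer, let $V=\begin{pmatrix}a&b\\c&d\end{pmatrix}\in\mathrm{SL}_2(\mathbb Z)$ with $j(V;r)\neq0$, and let $M=\begin{pmatrix}\vec x\\ \vec y\end{pmatrix}\in\mathrm M_2(V)\cap\mathrm M_2(r)$. Then $$S_{1,l}(r,M;\tau)-j(V;r)^{l-1}S_{1,l}(Vr,VM;\tau)=\frac{(-1)^l\,l!}{(2\pi i)^{l+1}}R_V(l,r,M;\tau)-\frac{(-1)^l\,l}{l+1}\,\frac{c}{j(V;r)}\,\frac{B_{l+1}(d(r)\vec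 x-n(r)\vec y;\tau)}{d(r)^{l+1}}.$$ -/

import Mathlib

open Complex Filter Topology

noncomputable section

/-- `e(z) = exp(2πiz)`. -/
def cexpTwoPiI (z : ℂ) : ℂ := Complex.exp (2 * Real.pi * I * z)

/-- Jacobi's theta function
`θ(x;τ) = ∑_{m ∈ ℤ} e((m + 1/2)² τ / 2 + (m + 1/2)(x + 1/2))`. -/
def thetaJacobi (x τ : ℂ) : ℂ :=
  ∑' m : ℤ, cexpTwoPiI (((m : ℂ) + 1 / 2) ^ 2 * τ / 2 + ((m : ℂ) + 1 / 2) * (x + 1 / 2))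

/-- Kronecker's double series: for `v = (x', x)`,
`F(v;X;τ) = e(xX) θ'(0;τ) θ(-x' + xτ + X;τ) / (θ(-x' + xτ;τ) θ(X;τ))`.
It is meaningful for `v ∉ ℤ²`. The entry `v 0` is `x'` and the entry `v 1` is `x`. -/
def kroneckerF (v : Fin 2 → ℝ) (X τ : ℂ) : ℂ :=
  cexpTwoPiI ((v 1 : ℂ) * X) *
    (deriv (fun x : ℂ => thetaJacobi x τ) 0 *
        thetaJacobi (-(v 0 : ℂ) + (v 1 : ℂ) * τ + X) τ /
      (thetaJacobi (-(v 0 : ℂ) + (v 1 : ℂ) * τ) τ * thetaJacobi X τ))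

/-- The function `X ↦ X F(v;X;τ)`, with its removable singularity at `X = 0` filled in. -/
def kroneckerFReg (v : Fin 2 → ℝ) (τ : ℂ) : ℂ → ℂ :=
  Function.update (fun X : ℂ => X * kroneckerF v X τ) 0
    (limUnder (𝓝[≠] (0 : ℂ)) (fun X : ℂ => X * kroneckerF v X τ))

/-- The elliptic Bernoulli function `B_m(v;τ)` for `v ∉ ℤ²`, given by the expansion
`F(v;X;τ) = ∑_{m ≥ 0} (B_m(v;τ) / m!) (2πi)^m X^{m-1}` at `X = 0`: the `m`-th Taylor coefficient
of `X F(v;X;τ)` at `0` is `(2πi)^m B_m(v;τ) / m!`. -/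
def ellipticBernoulli (m : ℕ) (v : Fin 2 → ℝ) (τ : ℂ) : ℂ :=
  iteratedDeriv m (kroneckerFReg v τ) 0 / (2 * Real.pi * I) ^ m

/-- The subset `ℤ²` of `ℝ²`. -/
def integerPoints : Set (Fin 2 → ℝ) := {v | ∃ a : Fin 2 → ℤ, ∀ i, v i = (a i : ℝ)}

/-- The elliptic Dedekind–Rademacher sum, for `M` with rows `x⃗ = M 0` and `y⃗ = M 1`:
`S_{m,n}(r,M;τ) = (1/d(r)) ∑_j B_m((j + y⃗)/d(r);τ) B_n(n(r)(j + y⃗)/d(r) - x⃗;τ)`,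
with `j` running over the representatives `{0, …, d(r) - 1}²` of `(ℤ/d(r)ℤ)²`. -/
def dedekindRademacher (m n : ℕ) (r : ℚ) (M : Matrix (Fin 2) (Fin 2) ℝ) (τ : ℂ) : ℂ :=
  1 / (r.den : ℂ) * ∑ j : Fin 2 → Fin r.den,
    ellipticBernoulli m (fun i => (((j i : ℕ) : ℝ) + M 1 i) / (r.den : ℝ)) τ *
      ellipticBernoulli n
        (fun i => (r.num : ℝ) * ((((j i : ℕ) : ℝ) + M 1 i) / (r.den : ℝ)) - M 0 i) τ

/-- The automorphic factor `j(V;z) = cz + d`. -/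
def autFactor {K : Type*} [Field K] (V : Matrix.SpecialLinearGroup (Fin 2) ℤ) (z : K) : K :=
  (V 1 0 : K) * z + (V 1 1 : K)

/-- `Vz = (az + b)/(cz + d)`. -/
def fracLin {K : Type*} [Field K] (V : Matrix.SpecialLinearGroup (Fin 2) ℤ) (z : K) : K :=
  ((V 0 0 : K) * z + (V 0 1 : K)) / autFactor V z

/-- The matrix product `VM` for `V ∈ SL₂(ℤ)` and `M ∈ M₂(ℝ)`. -/
def slMul (V : Matrix.SpecialLinearGroup (Fin 2) ℤ) (M : Matrix (Fin 2) (Fin 2) ℝ) :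
    Matrix (Fin 2) (Fin 2) ℝ :=
  (V : Matrix (Fin 2) (Fin 2) ℤ).map (fun k : ℤ => (k : ℝ)) * M

/-- `M₂(V)`: the matrices with `y⃗ ∉ ℤ²` and `c x⃗ + d y⃗ ∉ ℤ²`. -/
def matSetSL (V : Matrix.SpecialLinearGroup (Fin 2) ℤ) : Set (Matrix (Fin 2) (Fin 2) ℝ) :=
  {M | M 1 ∉ integerPoints ∧ (V 1 0 : ℝ) • M 0 + (V 1 1 : ℝ) • M 1 ∉ integerPoints}

/-- `M₂(r)`: the matrices with `y⃗ ∉ ℤ²` and `d(r) x⃗ - n(r) y⃗ ∉ ℤ²`. -/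
def matSetRat (r : ℚ) : Set (Matrix (Fin 2) (Fin 2) ℝ) :=
  {M | M 1 ∉ integerPoints ∧ (r.den : ℝ) • M 0 - (r.num : ℝ) • M 1 ∉ integerPoints}

/-- The expression defining `R_V(l,z,M;τ)` when `c > 0`:
`(2πi)^{l+1}/(l+1)! ∑_{k=-1}^{l} C(l+1,k+1) (-j(V;z))^k S_{k+1,l-k}(d/c, (-x⃗; y⃗); τ)`.
The pairs `p` are `(k + 1, l - k)`. -/
def periodSumPos (V : Matrix.SpecialLinearGroup (Fin 2) ℤ) (l : ℕ) (z : ℂ)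
    (M : Matrix (Fin 2) (Fin 2) ℝ) (τ : ℂ) : ℂ :=
  (2 * Real.pi * I) ^ (l + 1) / ((l + 1).factorial : ℂ) *
    ∑ p ∈ Finset.HasAntidiagonal.antidiagonal (l + 1),
      ((l + 1).choose p.1 : ℂ) * (-autFactor V z) ^ ((p.1 : ℤ) - 1) *
        dedekindRademacher p.1 p.2 ((V 1 1 : ℚ) / (V 1 0 : ℚ))
          (Matrix.of ![fun i => -M 0 i, M 1]) τ

/-- `R_V(l,z,M;τ)`: the sum above if `c > 0`, zero if `c = 0`, and `R_{-V}(l,z,M;τ)` if `c < 0`. -/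
def periodR (V : Matrix.SpecialLinearGroup (Fin 2) ℤ) (l : ℕ) (z : ℂ)
    (M : Matrix (Fin 2) (Fin 2) ℝ) (τ : ℂ) : ℂ :=
  if 0 < V 1 0 then periodSumPos V l z M τ
  else if V 1 0 = 0 then 0
  else periodSumPos (-V) l z M τ

end

/-!
The proof reduces the transformation law to one identity between functions on the torus `(ℝ/ℤ)²`,
and that identity to Liouville's theorem.

Analysis. Jacobi's theta function is a nonzero multiple of an infinite product
(`exists_thetaJacobi_eq`), so its zeros are exactly the points of `Λ = ℤ + ℤτ`, all of them simple.
Hence `F(v;X;τ)`, as a function of `X`, is analytic outside `Λ`, has a simple pole with residue `1`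
at the origin, and is multiplied by `e(x)` and `e(x')` under the translations by `1` and `τ`
(`isKronecker_kroneckerF`). These multipliers have modulus one and are not both `1` when `v ∉ ℤ²`,
so a combination of such functions with a common pair of multipliers vanishes as soon as its poles
cancel (`QuasiPeriodic.exists_const`). Comparing principal parts gives, for the coefficients
`β_m = (2πi)^m B_m / m!`, invariance under `ℤ²`, the parity `β_m(-v) = (-1)^m β_m(v)`, the degenerate
trisecant identity `F_v F_w = (β₁(v) + β₁(w)) F_{v+w} - F_{v+w}'` of Fay (`IsKronecker.fay`), and the
distribution relation `∑_{Nz = w} β_m(z) = N^{2-m} β_m(w)` (`sum_torusCoeff`), which holds for every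
nonzero integer `N`.

Algebra. Write `r = p/q` and `Vr = P/Q` with `Q = cp + dq`. The vectors `e₁ = -Q (1, 0)`,
`e₂ = q (d, -c)` and `e₃ = c (p, q)` add up to zero, so for two points `z₁`, `z₂` of the torus the
condition `z₁ e₁ - z₂ e₂ = M` can also be written in terms of `z₁ + z₂` and `z₂`, or of `z₁ + z₂` and
`z₁`. Fay's identity is summed over all such pairs. In each of its terms one of the two points runs
over a full set of division points and is removed by the distribution relation: the left-hand side
becomes the period sum, the two products with `β₁` become the sums attached to `r` and to `Vr`, and
the derivative becomes the term with `B_{l+1}` (`torus_relation`). The conditions `M ∈ M₂(V)` and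
`M ∈ M₂(r)` say precisely that `z₁`, `z₂` and `z₁ + z₂` are never zero.
-/

/-! ### Liouville's theorem for quasi-periodic functions -/

/-- The lattice `Λ = ℤ + ℤτ`. -/
def tauLattice (τ : ℂ) : Set ℂ := {z | ∃ m n : ℤ, z = m + n * τ}

/-- `f` agrees near `z`, the point `z` itself excepted, with a function that is analytic at `z`:
the singularity of `f` at `z` is at most removable. -/
def ExtendsAt (f : ℂ → ℂ) (z : ℂ) : Prop := ∃ h : ℂ → ℂ, AnalyticAt ℂ h z ∧ f =ᶠ[𝓝[≠] z] h

/-- `f` is multiplied by `a` under the translation by `1` and by `b` under the translation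
by `τ`. -/
structure QuasiPeriodic (τ a b : ℂ) (f : ℂ → ℂ) : Prop where
  add_one : ∀ z, f (z + 1) = a * f z
  add_tau : ∀ z, f (z + τ) = b * f z

lemma AnalyticAt.extendsAt {f : ℂ → ℂ} {z : ℂ} (hf : AnalyticAt ℂ f z) : ExtendsAt f z :=
  ⟨f, hf, EventuallyEq.rfl⟩

lemma zpow_mul_of_map_add {f : ℂ → ℂ} {a w : ℂ} (ha : a ≠ 0) (h : ∀ z, f (z + w) = a * f z)
    (n : ℤ) (z : ℂ) : f (z + n * w) = a ^ n * f z := by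
  induction n using Int.induction_on generalizing z with
  | zero => simp
  | succ k ih =>
    have := h (z + k * w)
    rw [show z + ((k + 1 : ℤ) : ℂ) * w = z + k * w + w by push_cast; ring, this]
    have := ih z
    push_cast at this
    rw [this, zpow_add₀ ha, zpow_one]; ring
  | pred k ih =>
    have := h (z + ((-k - 1 : ℤ) : ℂ) * w)
    rw [show z + ((-k - 1 : ℤ) : ℂ) * w + w = z + ((-k : ℤ) : ℂ) * w by push_cast; ring,
      ih z] at this
    rw [zpow_sub₀ ha, zpow_one]
    field_simp
    linear_combination -this

lemma QuasiPeriodic.add_lattice {τ a b : ℂ} {f : ℂ → ℂ} (hf : QuasiPeriodic τ a b f)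
    (ha : a ≠ 0) (hb : b ≠ 0) (m n : ℤ) (z : ℂ) :
    f (z + (m + n * τ)) = a ^ m * b ^ n * f z := by
  have h1 := zpow_mul_of_map_add (w := 1) ha hf.add_one m (z + n * τ)
  have h2 := zpow_mul_of_map_add hb hf.add_tau n z
  rw [h2] at h1
  rw [mul_assoc, ← h1]; congr 1; ring

lemma eventually_nhdsNE_add {p : ℂ → Prop} {z w : ℂ} (h : ∀ᶠ x in 𝓝[≠] z, p x) :
    ∀ᶠ x in 𝓝[≠] (z + w), p (x - w) := by
  have : Tendsto (fun x : ℂ => x - w) (𝓝[≠] (z + w)) (𝓝[≠] z) := by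
    apply tendsto_nhdsWithin_of_tendsto_nhds_of_eventually_within
    · have : ContinuousAt (fun x : ℂ => x - w) (z + w) := by fun_prop
      have h2 := this.tendsto
      simp only [add_sub_cancel_right] at h2
      exact h2.mono_left nhdsWithin_le_nhds
    · filter_upwards [self_mem_nhdsWithin] with x hx
      intro h3
      exact hx (by rw [Set.mem_singleton_iff] at *; linear_combination h3)
  exact this.eventually h

lemma eventually_nhdsNE_nhdsNE {p : ℂ → Prop} {z : ℂ} (h : ∀ᶠ x in 𝓝[≠] z, p x) :
    ∀ᶠ x in 𝓝[≠] z, ∀ᶠ y in 𝓝[≠] x, p y := by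
  rw [eventually_nhdsWithin_iff] at h
  have h2 := h.eventually_nhds
  rw [eventually_nhdsWithin_iff]
  filter_upwards [h2] with x hx hxz
  have h3 : ∀ᶠ y in 𝓝 x, y ∈ ({z}ᶜ : Set ℂ) := isOpen_compl_singleton.mem_nhds hxz
  exact (hx.and h3).filter_mono nhdsWithin_le_nhds |>.mono fun y hy => hy.1 hy.2

lemma QuasiPeriodic.extendsAt_lattice {τ a b : ℂ} {f : ℂ → ℂ} (hf : QuasiPeriodic τ a b f)
    (ha : a ≠ 0) (hb : b ≠ 0) (h0 : ExtendsAt f 0) {z : ℂ} (hz : z ∈ tauLattice τ) :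
    ExtendsAt f z := by
  obtain ⟨m, n, rfl⟩ := hz
  obtain ⟨h, hh, he⟩ := h0
  refine ⟨fun x => a ^ m * b ^ n * h (x - (m + n * τ)), ?_, ?_⟩
  · refine analyticAt_const.mul (AnalyticAt.fun_comp ?_ (by fun_prop))
    simpa using hh
  · have := eventually_nhdsNE_add (w := m + n * τ) he
    rw [zero_add] at this
    filter_upwards [this] with x hx
    rw [← hx, ← hf.add_lattice ha hb]
    congr 1; ring

/-- The translates of a compact parallelogram by the lattice cover the plane. -/
lemma exists_lattice_translate {τ : ℂ} (hτ : 0 < τ.im) (z : ℂ) : ∃ m n : ℤ,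
    ∃ s ∈ Set.Icc (0 : ℝ) 1, ∃ t ∈ Set.Icc (0 : ℝ) 1,
      z = ((s : ℂ) + t * τ) + (m + n * τ) := by
  set y := z.im / τ.im with hy
  set x := z.re - y * τ.re with hx
  refine ⟨⌊x⌋, ⌊y⌋, Int.fract x, ⟨Int.fract_nonneg _, (Int.fract_lt_one _).le⟩, Int.fract y,
    ⟨Int.fract_nonneg _, (Int.fract_lt_one _).le⟩, ?_⟩
  have e1 : ((Int.fract x : ℝ) : ℂ) + (⌊x⌋ : ℂ) = x := by exact_mod_cast Int.fract_add_floor x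
  have e2 : ((Int.fract y : ℝ) : ℂ) + (⌊y⌋ : ℂ) = y := by exact_mod_cast Int.fract_add_floor y
  have : z = x + y * τ := by
    apply Complex.ext
    · simp [hx]
    · simp [hy, hτ.ne']
  rw [this]
  linear_combination -e1 - τ * e2

/-- A function on `ℂ` with at most removable singularities whose multipliers under translation
by `1` and `τ` have modulus one is constant, and it vanishes unless both multipliers are `1`. -/
theorem QuasiPeriodic.exists_const {τ a b : ℂ} {f : ℂ → ℂ} (hτ : 0 < τ.im)
    (hf : QuasiPeriodic τ a b f) (ha : ‖a‖ = 1) (hb : ‖b‖ = 1) (he : ∀ z, ExtendsAt f z) :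
    ∃ C : ℂ, (∀ z, ∀ᶠ x in 𝓝[≠] z, f x = C) ∧ (C = 0 ∨ (a = 1 ∧ b = 1)) := by
  choose h hh hfh using he
  -- the function with all singularities removed
  set g : ℂ → ℂ := fun z => h z z with hg
  have key : ∀ z, ∀ k : ℂ → ℂ, ContinuousAt k z → f =ᶠ[𝓝[≠] z] k → k z = g z := by
    intro z k hk hfk
    have h1 : Tendsto f (𝓝[≠] z) (𝓝 (k z)) :=
      (hk.tendsto.mono_left nhdsWithin_le_nhds).congr' hfk.symm
    have h2 : Tendsto f (𝓝[≠] z) (𝓝 (h z z)) :=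
      ((hh z).continuousAt.tendsto.mono_left nhdsWithin_le_nhds).congr' (hfh z).symm
    exact tendsto_nhds_unique h1 h2
  have hgh : ∀ z, g =ᶠ[𝓝 z] h z := by
    intro z
    have h1 : ∀ᶠ x in 𝓝[≠] z, g x = h z x := by
      have h2 : ∀ᶠ x in 𝓝[≠] z, ContinuousAt (h z) x :=
        ((hh z).eventually_analyticAt.mono fun x hx => hx.continuousAt).filter_mono
          nhdsWithin_le_nhds
      filter_upwards [eventually_nhdsNE_nhdsNE (hfh z), h2] with x hx hx2
      exact (key x (h z) hx2 hx).symm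
    rw [eventually_nhdsWithin_iff] at h1
    filter_upwards [h1] with x hx
    by_cases hxz : x = z
    · rw [hxz]
    · exact hx hxz
  have hdiff : Differentiable ℂ g := fun z =>
    ((hh z).differentiableAt).congr_of_eventuallyEq (hgh z)
  have hqp : ∀ c w : ℂ, (∀ z, f (z + w) = c * f z) → ∀ z, g (z + w) = c * g z := by
    intro c w hcw z
    have := key (z + w) (fun x => c * h z (x - w)) ?_ ?_
    · rw [← this]; simp [hg]
    · have h3 : ContinuousAt (h z) (z + w - w) := by simpa using (hh z).continuousAt
      exact continuousAt_const.mul (ContinuousAt.comp (f := fun x => x - w) h3 (by fun_prop))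
    · filter_upwards [eventually_nhdsNE_add (w := w) (hfh z)] with x hx
      rw [← hx, ← hcw]; simp
  have hgq : QuasiPeriodic τ a b g := ⟨hqp _ _ hf.add_one, hqp _ _ hf.add_tau⟩
  have ha0 : a ≠ 0 := by intro h; simp [h] at ha
  have hb0 : b ≠ 0 := by intro h; simp [h] at hb
  have hbdd : Bornology.IsBounded (Set.range g) := by
    have hc : IsCompact ((fun p : ℝ × ℝ => g ((p.1 : ℂ) + p.2 * τ)) ''
        (Set.Icc (0 : ℝ) 1 ×ˢ Set.Icc (0 : ℝ) 1)) := by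
      apply (isCompact_Icc.prod isCompact_Icc).image
      have := hdiff.continuous
      fun_prop
    obtain ⟨R, hR⟩ := hc.isBounded.exists_norm_le
    refine (isBounded_iff_forall_norm_le).2 ⟨R, ?_⟩
    rintro _ ⟨z, rfl⟩
    obtain ⟨m, n, s, hs, t, ht, rfl⟩ := exists_lattice_translate hτ z
    rw [hgq.add_lattice ha0 hb0]
    simp only [norm_mul, norm_zpow, ha, hb, one_zpow, one_mul]
    exact hR _ ⟨(s, t), ⟨hs, ht⟩, rfl⟩
  have hconst : ∀ z, g z = g 0 := fun z => hdiff.apply_eq_apply_of_bounded hbdd z 0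
  refine ⟨g 0, fun z => ?_, ?_⟩
  · filter_upwards [hfh z, (hgh z).filter_mono nhdsWithin_le_nhds] with x h1 h2
    rw [h1, ← h2, hconst]
  · by_cases hC : g 0 = 0
    · exact Or.inl hC
    · right
      have e1 := hgq.add_one 0
      have e2 := hgq.add_tau 0
      rw [hconst] at e1 e2
      constructor
      · exact (mul_right_cancel₀ hC (by linear_combination e1)).symm
      · exact (mul_right_cancel₀ hC (by linear_combination e2)).symm

/-! ### The theta function and its zeros -/

lemma cexpTwoPiI_add (z w : ℂ) : cexpTwoPiI (z + w) = cexpTwoPiI z * cexpTwoPiI w := by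
  unfold cexpTwoPiI; rw [← Complex.exp_add]; congr 1; ring

lemma cexpTwoPiI_ne_zero (z : ℂ) : cexpTwoPiI z ≠ 0 := Complex.exp_ne_zero _

lemma cexpTwoPiI_zero : cexpTwoPiI 0 = 1 := by simp [cexpTwoPiI]

lemma cexpTwoPiI_neg (z : ℂ) : cexpTwoPiI (-z) = (cexpTwoPiI z)⁻¹ := by
  unfold cexpTwoPiI; rw [← Complex.exp_neg]; congr 1; ring

lemma cexpTwoPiI_eq_one_iff {z : ℂ} : cexpTwoPiI z = 1 ↔ ∃ n : ℤ, z = n := by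
  unfold cexpTwoPiI
  rw [Complex.exp_eq_one_iff]
  refine exists_congr fun n => ?_
  have := Complex.two_pi_I_ne_zero
  constructor
  · intro h; exact mul_left_cancel₀ this (by rw [h]; ring)
  · rintro rfl; ring

lemma cexpTwoPiI_one : cexpTwoPiI 1 = 1 := cexpTwoPiI_eq_one_iff.2 ⟨1, by simp⟩

lemma cexpTwoPiI_half : cexpTwoPiI (1 / 2) = -1 := by
  unfold cexpTwoPiI; rw [← Complex.exp_pi_mul_I]; congr 1; ring

lemma norm_cexpTwoPiI_ofReal (x : ℝ) : ‖cexpTwoPiI x‖ = 1 := by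
  unfold cexpTwoPiI
  rw [show 2 * (Real.pi : ℂ) * I * x = ((2 * Real.pi * x : ℝ) : ℂ) * I by push_cast; ring]
  exact Complex.norm_exp_ofReal_mul_I _

lemma cexpTwoPiI_nat_mul (n : ℕ) (z : ℂ) : cexpTwoPiI (n * z) = cexpTwoPiI z ^ n := by
  unfold cexpTwoPiI; rw [← Complex.exp_nat_mul]; congr 1; ring

lemma differentiable_cexpTwoPiI : Differentiable ℂ cexpTwoPiI := by
  unfold cexpTwoPiI; fun_prop

lemma norm_cexpTwoPiI_lt_one {τ : ℂ} (hτ : 0 < τ.im) : ‖cexpTwoPiI τ‖ < 1 :=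
  UpperHalfPlane.norm_exp_two_pi_I_lt_one ⟨τ, hτ⟩

lemma thetaJacobi_eq (x τ : ℂ) : thetaJacobi x τ =
    cexpTwoPiI (τ / 8 + (x + 1 / 2) / 2) * jacobiTheta₂ (x + 1 / 2 + τ / 2) τ := by
  unfold thetaJacobi jacobiTheta₂ jacobiTheta₂_term cexpTwoPiI
  rw [← tsum_mul_left]
  refine tsum_congr fun m => ?_
  rw [← Complex.exp_add]; congr 1; ring

lemma differentiable_thetaJacobi {τ : ℂ} (hτ : 0 < τ.im) :
    Differentiable ℂ (fun x => thetaJacobi x τ) := by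
  have : (fun x => thetaJacobi x τ) = fun x =>
      cexpTwoPiI (τ / 8 + (x + 1 / 2) / 2) * jacobiTheta₂ (x + 1 / 2 + τ / 2) τ :=
    funext fun x => thetaJacobi_eq x τ
  rw [this]
  refine (differentiable_cexpTwoPiI.comp (by fun_prop)).mul ?_
  have h : Differentiable ℂ (fun z => jacobiTheta₂ z τ) := fun z =>
    differentiableAt_jacobiTheta₂_fst z hτ
  exact h.comp (f := fun x : ℂ => x + 1 / 2 + τ / 2) (by fun_prop)

lemma thetaJacobi_add_one (x τ : ℂ) : thetaJacobi (x + 1) τ = -thetaJacobi x τ := by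
  rw [thetaJacobi_eq, thetaJacobi_eq, show x + 1 + 1 / 2 + τ / 2 = x + 1 / 2 + τ / 2 + 1 by ring,
    jacobiTheta₂_add_left, show τ / 8 + (x + 1 + 1 / 2) / 2 = τ / 8 + (x + 1 / 2) / 2 + 1 / 2 by ring,
    cexpTwoPiI_add, cexpTwoPiI_half]
  ring

lemma thetaJacobi_add_tau (x τ : ℂ) :
    thetaJacobi (x + τ) τ = -cexpTwoPiI (-τ / 2 - x) * thetaJacobi x τ := by
  rw [thetaJacobi_eq, thetaJacobi_eq, show x + τ + 1 / 2 + τ / 2 = x + 1 / 2 + τ / 2 + τ by ring,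
    jacobiTheta₂_add_left']
  have : cexp (-Real.pi * I * (τ + 2 * (x + 1 / 2 + τ / 2))) =
      cexpTwoPiI (-(τ + x + 1 / 2)) := by
    unfold cexpTwoPiI; congr 1; ring
  rw [this, ← mul_assoc, ← cexpTwoPiI_add, ← mul_assoc]
  congr 1
  have h2 : -cexpTwoPiI (-τ / 2 - x) = cexpTwoPiI (-(1 / 2)) * cexpTwoPiI (-τ / 2 - x) := by
    rw [cexpTwoPiI_neg, cexpTwoPiI_half]; norm_num
  rw [h2, ← cexpTwoPiI_add, ← cexpTwoPiI_add]; congr 1; ring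

lemma thetaJacobi_zero (τ : ℂ) : thetaJacobi 0 τ = 0 := by
  have h1 := thetaJacobi_eq 0 τ
  have h2 := jacobiTheta₂_neg_left (0 + 1 / 2 + τ / 2) τ
  have h3 := jacobiTheta₂_add_left' (-(0 + 1 / 2 + τ / 2)) τ
  have h4 := jacobiTheta₂_add_left (-(0 + 1 / 2 + τ / 2) + τ) τ
  rw [show -(0 + 1 / 2 + τ / 2) + τ + 1 = 0 + 1 / 2 + τ / 2 by ring] at h4
  rw [show -(Real.pi : ℂ) * I * (τ + 2 * -(0 + 1 / 2 + τ / 2)) = Real.pi * I by ring,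
    Complex.exp_pi_mul_I, h2] at h3
  rw [h3] at h4
  have h5 : jacobiTheta₂ (0 + 1 / 2 + τ / 2) τ = 0 := by linear_combination h4 / 2
  rw [h1, h5, mul_zero]

/-- The constant term of the Fourier series of `jacobiTheta₂ · τ` is `1`. -/
lemma exists_jacobiTheta₂_ne_zero {τ : ℂ} (hτ : 0 < τ.im) : ∃ z : ℂ, jacobiTheta₂ z τ ≠ 0 := by
  by_contra! h
  have hs : HasSum (fun n : ℤ => ∫ x in (0 : ℝ)..1, jacobiTheta₂_term n x τ)
      (∫ x in (0 : ℝ)..1, ∑' n : ℤ, jacobiTheta₂_term n x τ) := by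
    apply intervalIntegral.hasSum_intervalIntegral_of_summable_norm
      (f := fun n : ℤ => (⟨fun x : ℝ => jacobiTheta₂_term n x τ, by
        unfold jacobiTheta₂_term; fun_prop⟩ : C(ℝ, ℂ)))
    refine Summable.of_nonneg_of_le (fun _ => norm_nonneg _) (fun n => ?_)
      ((summable_jacobiTheta₂_term_iff 0 τ).2 hτ).norm
    rw [ContinuousMap.norm_le _ (norm_nonneg _)]
    intro x
    simp [norm_jacobiTheta₂_term]
  have h0 : (∫ x in (0 : ℝ)..1, ∑' n : ℤ, jacobiTheta₂_term n x τ) = 0 := by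
    have : ∀ x : ℝ, ∑' n : ℤ, jacobiTheta₂_term n x τ = 0 := fun x => h x
    simp [this]
  have hn : ∀ n : ℤ, n ≠ 0 → ∫ x in (0 : ℝ)..1, jacobiTheta₂_term n x τ = 0 := by
    intro n hn
    have hc : (2 * Real.pi * I * n : ℂ) ≠ 0 :=
      mul_ne_zero Complex.two_pi_I_ne_zero (by exact_mod_cast hn)
    have : ∀ x : ℝ, jacobiTheta₂_term n x τ =
        cexp (Real.pi * I * n ^ 2 * τ) * cexp (2 * Real.pi * I * n * x) := by
      intro x; unfold jacobiTheta₂_term; rw [← Complex.exp_add]; congr 1; ring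
    simp_rw [this]
    rw [intervalIntegral.integral_const_mul, integral_exp_mul_complex hc]
    have e : cexp (2 * Real.pi * I * n) = 1 :=
      Complex.exp_eq_one_iff.2 ⟨n, by ring⟩
    simp [e]
  have h1 := hs.unique (hasSum_single 0 hn)
  rw [h0] at h1
  simp [jacobiTheta₂_term] at h1

/-- The product `∏_{n ≥ 0} (1 - qⁿ w)`. -/
noncomputable def qProduct (q w : ℂ) : ℂ := ∏' n : ℕ, (1 + -(q ^ n * w))

lemma summable_norm_qProduct {q : ℂ} (hq : ‖q‖ < 1) (w : ℂ) :
    Summable fun n : ℕ => ‖-(q ^ n * w)‖ := by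
  simp only [norm_neg, norm_mul, norm_pow]
  exact (summable_geometric_of_lt_one (norm_nonneg _) hq).mul_right _

lemma differentiable_qProduct {q : ℂ} (hq : ‖q‖ < 1) : Differentiable ℂ (qProduct q) := by
  intro w
  have hK : IsOpen (Metric.ball (0 : ℂ) (‖w‖ + 1)) := Metric.isOpen_ball
  have hp := Summable.hasProdLocallyUniformlyOn_nat_one_add (f := fun n w => -(q ^ n * w))
    hK ((summable_geometric_of_lt_one (norm_nonneg q) hq).mul_right (‖w‖ + 1))
    (.of_forall fun n x hx => by
      simp only [norm_neg, norm_mul, norm_pow]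
      have : ‖x‖ ≤ ‖w‖ + 1 := by simpa using (Metric.mem_ball.1 hx).le
      gcongr) (fun n => by fun_prop)
  have hd : DifferentiableOn ℂ (qProduct q) (Metric.ball (0 : ℂ) (‖w‖ + 1)) :=
    hp.differentiableOn (.of_forall fun _ => by
      simpa [Finset.prod_fn] using DifferentiableOn.finsetProd (fun _ _ => by fun_prop)) hK
  exact hd.differentiableAt (hK.mem_nhds (by simp))

lemma qProduct_eq_mul {q : ℂ} (hq : ‖q‖ < 1) (w : ℂ) :
    qProduct q w = (1 - w) * qProduct q (q * w) := by
  have h := (multipliable_one_add_of_summable (summable_norm_qProduct hq (q * w)))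
  unfold qProduct
  rw [tprod_eq_zero_mul' (by simpa only [pow_succ, mul_assoc] using h)]
  simp only [pow_zero, one_mul, sub_eq_add_neg, pow_succ, mul_assoc]

lemma qProduct_ne_zero {q w : ℂ} (hq : ‖q‖ < 1) (h : ∀ n : ℕ, q ^ n * w ≠ 1) :
    qProduct q w ≠ 0 :=
  tprod_one_add_ne_zero_of_summable
    (fun n => by rw [← sub_eq_add_neg, sub_ne_zero]; exact (h n).symm)
    (summable_norm_qProduct hq w)

/-- The entire function `e(-x/2) ∏_{n ≥ 0} (1 - qⁿ e(x)) (1 - qⁿ⁺¹ e(-x))`, where `q = e(τ)`.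
It is a constant multiple of the theta function by Jacobi's triple product. -/
noncomputable def thetaProduct (τ x : ℂ) : ℂ :=
  cexpTwoPiI (-x / 2) * qProduct (cexpTwoPiI τ) (cexpTwoPiI x) *
    qProduct (cexpTwoPiI τ) (cexpTwoPiI τ * cexpTwoPiI (-x))

/-- The theta product without the factor `1 - e(x)`, which carries the zero at `x = 0`. -/
noncomputable def thetaCofactor (τ x : ℂ) : ℂ :=
  cexpTwoPiI (-x / 2) * qProduct (cexpTwoPiI τ) (cexpTwoPiI τ * cexpTwoPiI x) *
    qProduct (cexpTwoPiI τ) (cexpTwoPiI τ * cexpTwoPiI (-x))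

lemma thetaProduct_eq {τ : ℂ} (hτ : 0 < τ.im) (x : ℂ) :
    thetaProduct τ x = (1 - cexpTwoPiI x) * thetaCofactor τ x := by
  unfold thetaProduct thetaCofactor
  rw [qProduct_eq_mul (norm_cexpTwoPiI_lt_one hτ) (cexpTwoPiI x)]
  ring

lemma differentiable_thetaCofactor {τ : ℂ} (hτ : 0 < τ.im) :
    Differentiable ℂ (thetaCofactor τ) := by
  have h1 := differentiable_qProduct (norm_cexpTwoPiI_lt_one hτ)
  have h2 := differentiable_cexpTwoPiI
  unfold thetaCofactor
  refine ((h2.comp (by fun_prop)).mul (h1.comp ?_)).mul (h1.comp ?_)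
  · exact h2.const_mul _
  · exact (h2.comp differentiable_neg).const_mul _

lemma thetaCofactor_zero_ne_zero {τ : ℂ} (hτ : 0 < τ.im) : thetaCofactor τ 0 ≠ 0 := by
  have hq := norm_cexpTwoPiI_lt_one hτ
  have h : qProduct (cexpTwoPiI τ) (cexpTwoPiI τ * 1) ≠ 0 := by
    refine qProduct_ne_zero hq fun n h => ?_
    have h2 := congrArg norm h
    rw [mul_one, ← pow_succ, norm_pow, norm_one] at h2
    exact (pow_lt_one₀ (norm_nonneg _) hq n.succ_ne_zero).ne h2
  simp only [thetaCofactor, neg_zero, zero_div, cexpTwoPiI_zero]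
  exact mul_ne_zero (mul_ne_zero one_ne_zero h) h

lemma thetaProduct_ne_zero {τ z : ℂ} (hτ : 0 < τ.im) (hz : z ∉ tauLattice τ) :
    thetaProduct τ z ≠ 0 := by
  have hq := norm_cexpTwoPiI_lt_one hτ
  refine mul_ne_zero (mul_ne_zero (cexpTwoPiI_ne_zero _) ?_) ?_ <;>
    refine qProduct_ne_zero hq fun n h => hz ?_
  · rw [← cexpTwoPiI_nat_mul, ← cexpTwoPiI_add, cexpTwoPiI_eq_one_iff] at h
    obtain ⟨m, hm⟩ := h
    exact ⟨m, -n, by push_cast; linear_combination hm⟩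
  · rw [← cexpTwoPiI_nat_mul, ← cexpTwoPiI_add, ← cexpTwoPiI_add, cexpTwoPiI_eq_one_iff] at h
    obtain ⟨m, hm⟩ := h
    exact ⟨-m, n + 1, by push_cast; linear_combination -hm⟩

lemma thetaProduct_add_one (τ x : ℂ) : thetaProduct τ (x + 1) = -thetaProduct τ x := by
  have h1 : cexpTwoPiI (-(x + 1) / 2) = -cexpTwoPiI (-x / 2) := by
    rw [show -(x + 1) / 2 = -x / 2 + -(1 / 2) by ring, cexpTwoPiI_add, cexpTwoPiI_neg,
      cexpTwoPiI_half]
    norm_num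
  have h2 : cexpTwoPiI (-(x + 1)) = cexpTwoPiI (-x) := by
    rw [cexpTwoPiI_neg, cexpTwoPiI_neg, cexpTwoPiI_add, cexpTwoPiI_one, mul_one]
  unfold thetaProduct
  rw [h1, h2, cexpTwoPiI_add, cexpTwoPiI_one]; ring_nf

lemma thetaProduct_add_tau {τ : ℂ} (hτ : 0 < τ.im) (x : ℂ) :
    thetaProduct τ (x + τ) = -cexpTwoPiI (-τ / 2 - x) * thetaProduct τ x := by
  have hq := norm_cexpTwoPiI_lt_one hτ
  have h1 : cexpTwoPiI τ * cexpTwoPiI (-(x + τ)) = cexpTwoPiI (-x) := by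
    rw [← cexpTwoPiI_add]; congr 1; ring
  have h2 : cexpTwoPiI (-(x + τ) / 2) = cexpTwoPiI (-τ / 2) * cexpTwoPiI (-x / 2) := by
    rw [← cexpTwoPiI_add]; congr 1; ring
  have h3 : cexpTwoPiI x * cexpTwoPiI (-x) = 1 := by
    rw [← cexpTwoPiI_add, add_neg_cancel, cexpTwoPiI_zero]
  have h4 : cexpTwoPiI (-τ / 2 - x) = cexpTwoPiI (-τ / 2) * cexpTwoPiI (-x) := by
    rw [← cexpTwoPiI_add]; congr 1
  unfold thetaProduct
  rw [h1, h2, h4, cexpTwoPiI_add, qProduct_eq_mul hq (cexpTwoPiI (-x)),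
    qProduct_eq_mul hq (cexpTwoPiI x), mul_comm (cexpTwoPiI x) (cexpTwoPiI τ)]
  linear_combination (-cexpTwoPiI (-τ / 2) * cexpTwoPiI (-x / 2) *
    qProduct (cexpTwoPiI τ) (cexpTwoPiI τ * cexpTwoPiI x) *
    qProduct (cexpTwoPiI τ) (cexpTwoPiI τ * cexpTwoPiI (-x))) * h3

lemma deriv_one_sub_cexpTwoPiI : deriv (fun x => 1 - cexpTwoPiI x) 0 = -(2 * Real.pi * I) := by
  have h : HasDerivAt (fun x : ℂ => 1 - cexp (2 * Real.pi * I * x))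
      (-(cexp (2 * Real.pi * I * 0) * (2 * Real.pi * I * 1))) 0 :=
    (((hasDerivAt_id (0 : ℂ)).const_mul (2 * Real.pi * I)).cexp).const_sub 1
  have := h.deriv
  simpa [cexpTwoPiI] using this

lemma Differentiable.analyticAt_dslope {f : ℂ → ℂ} (hf : Differentiable ℂ f) (z w : ℂ) :
    AnalyticAt ℂ (dslope f z) w := by
  have h : DifferentiableOn ℂ (dslope f z) Set.univ :=
    (Complex.differentiableOn_dslope Filter.univ_mem).2 hf.differentiableOn
  exact (differentiableOn_univ.1 h).analyticAt w

lemma eq_mul_dslope {f : ℂ → ℂ} (h0 : f 0 = 0) (x : ℂ) : f x = x * dslope f 0 x := by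
  have := sub_smul_dslope f 0 x
  simp only [sub_zero, h0, smul_eq_mul] at this
  exact this.symm

/-- The theta function is a nonzero multiple of its product: the quotient of the two is an
elliptic function whose singularities are removable. -/
theorem exists_thetaJacobi_eq {τ : ℂ} (hτ : 0 < τ.im) :
    ∃ C : ℂ, C ≠ 0 ∧ ∀ x, thetaJacobi x τ = C * thetaProduct τ x := by
  have hθ := differentiable_thetaJacobi hτ
  have hK := differentiable_thetaCofactor hτ
  have hs : Differentiable ℂ (fun x => 1 - cexpTwoPiI x) :=
    differentiable_cexpTwoPiI.const_sub 1
  have hP : Differentiable ℂ (thetaProduct τ) := by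
    rw [funext (thetaProduct_eq hτ)]; exact hs.mul hK
  have hqp : QuasiPeriodic τ 1 1 (fun x => thetaJacobi x τ / thetaProduct τ x) := by
    constructor
    · intro z
      simp only [thetaJacobi_add_one, thetaProduct_add_one, neg_div_neg_eq, one_mul]
    · intro z
      simp only [thetaJacobi_add_tau, thetaProduct_add_tau hτ, one_mul]
      exact mul_div_mul_left _ _ (neg_ne_zero.2 (cexpTwoPiI_ne_zero _))
  have h0 : ExtendsAt (fun x => thetaJacobi x τ / thetaProduct τ x) 0 := by
    refine ⟨fun x => dslope (fun x => thetaJacobi x τ) 0 x /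
      (dslope (fun x => 1 - cexpTwoPiI x) 0 x * thetaCofactor τ x), ?_, ?_⟩
    · refine (hθ.analyticAt_dslope 0 0).div
        ((hs.analyticAt_dslope 0 0).mul (hK.analyticAt 0)) ?_
      rw [dslope_same, deriv_one_sub_cexpTwoPiI]
      exact mul_ne_zero (neg_ne_zero.2 Complex.two_pi_I_ne_zero) (thetaCofactor_zero_ne_zero hτ)
    · filter_upwards [self_mem_nhdsWithin] with x hx
      rw [thetaProduct_eq hτ, eq_mul_dslope (f := fun x => thetaJacobi x τ) (thetaJacobi_zero τ) x,
        eq_mul_dslope (f := fun x => 1 - cexpTwoPiI x) (by simp [cexpTwoPiI_zero]) x, mul_assoc]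
      exact mul_div_mul_left _ _ hx
  obtain ⟨C, hC, -⟩ := hqp.exists_const hτ (by simp) (by simp) (fun z => by
    by_cases hz : z ∈ tauLattice τ
    · exact hqp.extendsAt_lattice one_ne_zero one_ne_zero h0 hz
    · exact ((hθ.analyticAt z).div (hP.analyticAt z) (thetaProduct_ne_zero hτ hz)).extendsAt)
  have hPne : ∀ z, ∀ᶠ x in 𝓝[≠] z, thetaProduct τ x ≠ 0 := by
    intro z
    rcases (hP.analyticAt z).eventually_eq_zero_or_eventually_ne_zero with h | h
    · exfalso
      have h2 := AnalyticOnNhd.eqOn_zero_of_preconnected_of_eventuallyEq_zero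
        (fun w _ => hP.analyticAt w) isPreconnected_univ (Set.mem_univ z) h
      have h3 : (1 / 2 : ℂ) ∉ tauLattice τ := by
        rintro ⟨m, n, hmn⟩
        have him := congrArg Complex.im hmn
        simp at him
        rcases him with h | h
        · rw [h] at hmn
          have : (2 * m : ℤ) = 1 := by
            have : (2 * m : ℂ) = 1 := by linear_combination -2 * hmn
            exact_mod_cast this
          omega
        · exact hτ.ne' h
      exact thetaProduct_ne_zero hτ h3 (h2 (Set.mem_univ _))
    · exact h
  have heq : ∀ x, thetaJacobi x τ = C * thetaProduct τ x := by
    intro x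
    have h1 : (fun x => thetaJacobi x τ) =ᶠ[𝓝[≠] x] fun x => C * thetaProduct τ x := by
      filter_upwards [hC x, hPne x] with y hy hy2
      rw [← hy]; field_simp
    have h2 : Tendsto (fun x => thetaJacobi x τ) (𝓝[≠] x) (𝓝 (thetaJacobi x τ)) :=
      (hθ x).continuousAt.tendsto.mono_left nhdsWithin_le_nhds
    have h3 : Tendsto (fun x => C * thetaProduct τ x) (𝓝[≠] x) (𝓝 (C * thetaProduct τ x)) :=
      ((hP x).continuousAt.const_mul C).tendsto.mono_left nhdsWithin_le_nhds
    exact tendsto_nhds_unique h2 (h3.congr' h1.symm)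
  refine ⟨C, ?_, heq⟩
  rintro rfl
  obtain ⟨z, hz⟩ := exists_jacobiTheta₂_ne_zero hτ
  have h1 := thetaJacobi_eq (z - 1 / 2 - τ / 2) τ
  rw [heq, show z - 1 / 2 - τ / 2 + 1 / 2 + τ / 2 = z by ring, zero_mul] at h1
  exact mul_ne_zero (cexpTwoPiI_ne_zero _) hz h1.symm

lemma thetaJacobi_ne_zero {τ z : ℂ} (hτ : 0 < τ.im) (hz : z ∉ tauLattice τ) :
    thetaJacobi z τ ≠ 0 := by
  obtain ⟨C, hC, h⟩ := exists_thetaJacobi_eq hτ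
  rw [h]; exact mul_ne_zero hC (thetaProduct_ne_zero hτ hz)

lemma deriv_thetaJacobi_zero_ne_zero {τ : ℂ} (hτ : 0 < τ.im) :
    deriv (fun x => thetaJacobi x τ) 0 ≠ 0 := by
  obtain ⟨C, hC, h⟩ := exists_thetaJacobi_eq hτ
  have hs : Differentiable ℂ (fun x => 1 - cexpTwoPiI x) :=
    differentiable_cexpTwoPiI.const_sub 1
  have hd := ((hs 0).hasDerivAt.mul (differentiable_thetaCofactor hτ 0).hasDerivAt).const_mul C
  have : (fun x => thetaJacobi x τ) =
      fun x => C * ((fun x => 1 - cexpTwoPiI x) * thetaCofactor τ) x :=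
    funext fun x => by rw [h, thetaProduct_eq hτ]; rfl
  rw [this, hd.deriv, deriv_one_sub_cexpTwoPiI, cexpTwoPiI_zero, sub_self, zero_mul, add_zero]
  exact mul_ne_zero hC (mul_ne_zero (neg_ne_zero.2 Complex.two_pi_I_ne_zero)
    (thetaCofactor_zero_ne_zero hτ))

/-! ### Taylor coefficients -/

/-- The `m`-th Taylor coefficient of `f` at `0`. -/
noncomputable def taylorCoeff (m : ℕ) (f : ℂ → ℂ) : ℂ := iteratedDeriv m f 0 / m.factorial

lemma taylorCoeff_congr {f g : ℂ → ℂ} (h : f =ᶠ[𝓝 0] g) (m : ℕ) :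
    taylorCoeff m f = taylorCoeff m g := by
  rw [taylorCoeff, h.iteratedDeriv_eq, taylorCoeff]

lemma taylorCoeff_zero (f : ℂ → ℂ) : taylorCoeff 0 f = f 0 := by simp [taylorCoeff]

lemma taylorCoeff_one (f : ℂ → ℂ) : taylorCoeff 1 f = deriv f 0 := by simp [taylorCoeff]

lemma taylorCoeff_deriv (m : ℕ) (f : ℂ → ℂ) :
    taylorCoeff m (deriv f) = (m + 1) * taylorCoeff (m + 1) f := by
  have : (m.factorial : ℂ) ≠ 0 := by exact_mod_cast m.factorial_ne_zero
  have : (m + 1 : ℂ) ≠ 0 := by exact_mod_cast m.succ_ne_zero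
  rw [taylorCoeff, taylorCoeff, iteratedDeriv_succ', Nat.factorial_succ]
  push_cast; field_simp

lemma taylorCoeff_mul {f g : ℂ → ℂ} (hf : AnalyticAt ℂ f 0) (hg : AnalyticAt ℂ g 0) (m : ℕ) :
    taylorCoeff m (f * g) =
      ∑ p ∈ Finset.HasAntidiagonal.antidiagonal m, taylorCoeff p.1 f * taylorCoeff p.2 g := by
  rw [taylorCoeff, iteratedDeriv_mul hf.contDiffAt hg.contDiffAt,
    Finset.Nat.sum_antidiagonal_eq_sum_range_succ
      (fun i j => taylorCoeff i f * taylorCoeff j g), Finset.sum_div]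
  refine Finset.sum_congr rfl fun i hi => ?_
  have hi : i ≤ m := Nat.lt_succ_iff.1 (Finset.mem_range.1 hi)
  have h1 : (m.factorial : ℂ) ≠ 0 := by exact_mod_cast m.factorial_ne_zero
  have h2 : (i.factorial : ℂ) ≠ 0 := by exact_mod_cast i.factorial_ne_zero
  have h3 : ((m - i).factorial : ℂ) ≠ 0 := by exact_mod_cast (m - i).factorial_ne_zero
  rw [taylorCoeff, taylorCoeff, Nat.cast_choose ℂ hi]
  field_simp

lemma taylorCoeff_const_mul (c : ℂ) (f : ℂ → ℂ) (m : ℕ) :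
    taylorCoeff m (fun x => c * f x) = c * taylorCoeff m f := by
  rw [taylorCoeff, iteratedDeriv_const_mul_field, taylorCoeff, mul_div_assoc]

lemma taylorCoeff_sub {f g : ℂ → ℂ} (hf : AnalyticAt ℂ f 0) (hg : AnalyticAt ℂ g 0) (m : ℕ) :
    taylorCoeff m (f - g) = taylorCoeff m f - taylorCoeff m g := by
  rw [taylorCoeff, iteratedDeriv_sub hf.contDiffAt hg.contDiffAt, sub_div]; rfl

lemma taylorCoeff_sum {ι : Type*} {s : Finset ι} {f : ι → ℂ → ℂ}
    (hf : ∀ i ∈ s, AnalyticAt ℂ (f i) 0) (m : ℕ) :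
    taylorCoeff m (fun x => ∑ i ∈ s, f i x) = ∑ i ∈ s, taylorCoeff m (f i) := by
  rw [taylorCoeff, iteratedDeriv_fun_sum (fun i hi => (hf i hi).contDiffAt), Finset.sum_div]; rfl

lemma taylorCoeff_id_mul {f : ℂ → ℂ} (hf : AnalyticAt ℂ f 0) (m : ℕ) :
    taylorCoeff (m + 1) (id * f) = taylorCoeff m f := by
  rw [taylorCoeff_mul analyticAt_id hf, Finset.sum_eq_single (1, m)]
  · simp [taylorCoeff_one]
  · rintro ⟨i, j⟩ hij hne
    have hi : i ≠ 1 := by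
      rintro rfl
      rw [Finset.HasAntidiagonal.mem_antidiagonal] at hij
      exact hne (Prod.ext rfl (by simp only at hij ⊢; omega))
    have : taylorCoeff i id = 0 := by
      rcases i with _ | _ | i
      · simp [taylorCoeff_zero]
      · exact absurd rfl hi
      · rw [taylorCoeff, iteratedDeriv_succ', iteratedDeriv_succ']; simp
    simp [this]
  · intro h
    exact absurd (Finset.HasAntidiagonal.mem_antidiagonal.2 (add_comm 1 m)) h

lemma iteratedDeriv_comp_mul_left (c : ℂ) (f : ℂ → ℂ) (m : ℕ) :
    iteratedDeriv m (fun x => f (c * x)) = fun x => c ^ m * iteratedDeriv m f (c * x) := by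
  induction m with
  | zero => simp
  | succ m ih =>
    funext x
    rw [iteratedDeriv_succ, ih, deriv_const_mul_field]
    rw [deriv_comp_mul_left c (iteratedDeriv m f) x, iteratedDeriv_succ, smul_eq_mul, pow_succ,
      mul_assoc]

lemma taylorCoeff_comp_mul_left (c : ℂ) (f : ℂ → ℂ) (m : ℕ) :
    taylorCoeff m (fun x => f (c * x)) = c ^ m * taylorCoeff m f := by
  rw [taylorCoeff, iteratedDeriv_comp_mul_left, taylorCoeff]
  simp only [mul_zero, mul_div_assoc]

lemma AnalyticAt.exists_eq_mul {f : ℂ → ℂ} (hf : AnalyticAt ℂ f 0) (h0 : f 0 = 0) :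
    ∃ g, AnalyticAt ℂ g 0 ∧ g 0 = deriv f 0 ∧ ∀ x, f x = x * g x := by
  obtain ⟨p, hp⟩ := hf
  exact ⟨dslope f 0, hp.has_fpower_series_dslope_fslope.analyticAt, dslope_same f 0,
    eq_mul_dslope h0⟩

/-! ### Functions with the properties of Kronecker's double series -/

/-- The properties that characterise Kronecker's double series: `f` is analytic outside the
lattice, has multipliers `a` and `b`, and has a simple pole with residue `1` at the origin, where
`r` is the regular function `x f(x)`. -/
structure IsKronecker (τ a b : ℂ) (f r : ℂ → ℂ) : Prop where
  analyticAt : ∀ z ∉ tauLattice τ, AnalyticAt ℂ f z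
  quasi : QuasiPeriodic τ a b f
  reg : AnalyticAt ℂ r 0
  reg_zero : r 0 = 1
  eventually_eq : ∀ᶠ x in 𝓝[≠] (0 : ℂ), f x = r x / x

lemma QuasiPeriodic.eventually_eq_zero {τ a b : ℂ} {f : ℂ → ℂ} (hτ : 0 < τ.im)
    (hf : QuasiPeriodic τ a b f) (ha : ‖a‖ = 1) (hb : ‖b‖ = 1) (hab : ¬(a = 1 ∧ b = 1))
    (he : ∀ z, ExtendsAt f z) : ∀ᶠ x in 𝓝[≠] (0 : ℂ), f x = 0 := by
  obtain ⟨C, hC, h | h⟩ := hf.exists_const hτ ha hb he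
  · simpa [h] using hC 0
  · exact absurd h hab

lemma eventuallyEq_of_nhdsNE {r s : ℂ → ℂ} (h0 : r 0 = s 0)
    (h : ∀ᶠ x in 𝓝[≠] (0 : ℂ), r x = s x) : r =ᶠ[𝓝 0] s := by
  rw [eventually_nhdsWithin_iff] at h
  filter_upwards [h] with x hx
  by_cases hx0 : x = 0
  · rw [hx0, h0]
  · exact hx hx0

lemma eventually_ne_zero_nhdsNE : ∀ᶠ x in 𝓝[≠] (0 : ℂ), x ≠ 0 := self_mem_nhdsWithin

/-- Kronecker's double series is determined by its multipliers. -/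
theorem IsKronecker.unique {τ a b : ℂ} {f r g s : ℂ → ℂ} (hτ : 0 < τ.im)
    (hf : IsKronecker τ a b f r) (hg : IsKronecker τ a b g s) (ha : ‖a‖ = 1) (hb : ‖b‖ = 1)
    (hab : ¬(a = 1 ∧ b = 1)) : r =ᶠ[𝓝 0] s := by
  have ha0 : a ≠ 0 := by rintro rfl; simp at ha
  have hb0 : b ≠ 0 := by rintro rfl; simp at hb
  have hq : QuasiPeriodic τ a b (fun x => f x - g x) :=
    ⟨fun z => by rw [hf.quasi.add_one, hg.quasi.add_one]; ring,
      fun z => by rw [hf.quasi.add_tau, hg.quasi.add_tau]; ring⟩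
  have h0 : ExtendsAt (fun x => f x - g x) 0 := by
    obtain ⟨h, hh, -, he⟩ := (hf.reg.sub hg.reg).exists_eq_mul (by
      simp [hf.reg_zero, hg.reg_zero])
    refine ⟨h, hh, ?_⟩
    filter_upwards [hf.eventually_eq, hg.eventually_eq, eventually_ne_zero_nhdsNE]
      with x h1 h2 hx
    have := he x
    rw [h1, h2, ← sub_div, div_eq_iff hx, mul_comm]
    exact this
  have hz := hq.eventually_eq_zero hτ ha hb hab fun z => by
    by_cases hz : z ∈ tauLattice τ
    · exact hq.extendsAt_lattice ha0 hb0 h0 hz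
    · exact ((hf.analyticAt z hz).sub (hg.analyticAt z hz)).extendsAt
  refine eventuallyEq_of_nhdsNE (by rw [hf.reg_zero, hg.reg_zero]) ?_
  filter_upwards [hz, hf.eventually_eq, hg.eventually_eq, eventually_ne_zero_nhdsNE]
    with x h h1 h2 hx
  rw [h1, h2, ← sub_div, div_eq_zero_iff] at h
  exact sub_eq_zero.1 (h.resolve_right hx)

lemma neg_mem_tauLattice {τ z : ℂ} : -z ∈ tauLattice τ ↔ z ∈ tauLattice τ := by
  constructor
  · rintro ⟨m, n, h⟩; exact ⟨-m, -n, by push_cast; linear_combination -h⟩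
  · rintro ⟨m, n, h⟩; exact ⟨-m, -n, by push_cast; linear_combination -h⟩

lemma tendsto_mul_nhdsNE_zero {c : ℂ} (hc : c ≠ 0) :
    Tendsto (fun x : ℂ => c * x) (𝓝[≠] 0) (𝓝[≠] 0) := by
  apply tendsto_nhdsWithin_of_tendsto_nhds_of_eventually_within
  · have : ContinuousAt (fun x : ℂ => c * x) 0 := by fun_prop
    have h2 := this.tendsto
    simp only [mul_zero] at h2
    exact h2.mono_left nhdsWithin_le_nhds
  · filter_upwards [eventually_ne_zero_nhdsNE] with x hx
    exact mul_ne_zero hc hx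

lemma IsKronecker.neg {τ a b : ℂ} {f r : ℂ → ℂ} (hf : IsKronecker τ a b f r) (ha : a ≠ 0)
    (hb : b ≠ 0) : IsKronecker τ a⁻¹ b⁻¹ (fun x => -f (-x)) (fun x => r (-1 * x)) where
  analyticAt z hz := by
    have h : AnalyticAt ℂ f (-z) := hf.analyticAt _ (fun h => hz (neg_mem_tauLattice.1 h))
    exact (h.fun_comp (f := fun x => -x) analyticAt_id.neg).neg
  quasi := by
    constructor
    · intro z
      have := hf.quasi.add_one (-(z + 1))
      rw [show -(z + 1) + 1 = -z by ring] at this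
      rw [this]; field_simp
    · intro z
      have := hf.quasi.add_tau (-(z + τ))
      rw [show -(z + τ) + τ = -z by ring] at this
      rw [this]; field_simp
  reg := by
    have h : AnalyticAt ℂ r (-1 * 0) := by simpa using hf.reg
    exact h.fun_comp (f := fun x => -1 * x) (by fun_prop)
  reg_zero := by simp [hf.reg_zero]
  eventually_eq := by
    filter_upwards [(tendsto_mul_nhdsNE_zero (c := -1) (by norm_num)).eventually
      hf.eventually_eq] with x hx
    rw [show -x = -1 * x by ring, hx]
    simp [div_neg]

lemma QuasiPeriodic.deriv {τ a b : ℂ} {f : ℂ → ℂ} (hf : QuasiPeriodic τ a b f) :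
    QuasiPeriodic τ a b (deriv f) := by
  constructor
  · intro z
    rw [← deriv_comp_add_const, ← deriv_const_mul_field]
    exact congrArg (fun g => _root_.deriv g z) (funext hf.add_one)
  · intro z
    rw [← deriv_comp_add_const, ← deriv_const_mul_field]
    exact congrArg (fun g => _root_.deriv g z) (funext hf.add_tau)

lemma IsKronecker.eventually_deriv_eq {τ a b : ℂ} {f r : ℂ → ℂ} (hf : IsKronecker τ a b f r) :
    ∀ᶠ x in 𝓝[≠] (0 : ℂ), deriv f x = (x * deriv r x - r x) / x ^ 2 := by
  have hr : ∀ᶠ x in 𝓝[≠] (0 : ℂ), AnalyticAt ℂ r x :=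
    hf.reg.eventually_analyticAt.filter_mono nhdsWithin_le_nhds
  have h := hf.eventually_eq
  rw [eventually_nhdsWithin_iff] at h
  filter_upwards [h.eventually_nhds.filter_mono nhdsWithin_le_nhds, hr,
    eventually_ne_zero_nhdsNE] with x hx hrx hx0
  have h1 : f =ᶠ[𝓝 x] fun y => r y / y := by
    filter_upwards [hx, isOpen_compl_singleton.mem_nhds hx0] with y hy hy0
    exact hy hy0
  rw [h1.deriv_eq]
  have h2 := hrx.differentiableAt.hasDerivAt.div (hasDerivAt_id x) hx0
  have h3 : (fun y => r y / y) = r / id := rfl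
  rw [h3, h2.deriv]
  simp only [id, mul_one]
  rw [mul_comm x]

/-- The degenerate form of Fay's trisecant identity,
`F_v F_w = (β₁(v) + β₁(w)) F_{v+w} - F_{v+w}'`, read off at each Taylor coefficient. The
difference of the two sides has no pole at the origin, so it vanishes by Liouville's theorem. -/
theorem IsKronecker.fay {τ a b a' b' : ℂ} {f r g s k t : ℂ → ℂ} (hτ : 0 < τ.im)
    (hf : IsKronecker τ a b f r) (hg : IsKronecker τ a' b' g s)
    (hk : IsKronecker τ (a * a') (b * b') k t) (ha : ‖a * a'‖ = 1) (hb : ‖b * b'‖ = 1)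
    (hab : ¬(a * a' = 1 ∧ b * b' = 1)) (l : ℕ) :
    ∑ p ∈ Finset.HasAntidiagonal.antidiagonal (l + 1), taylorCoeff p.1 r * taylorCoeff p.2 s =
      (taylorCoeff 1 r + taylorCoeff 1 s) * taylorCoeff l t - l * taylorCoeff (l + 1) t := by
  have ha0 : a * a' ≠ 0 := by intro h; simp [h] at ha
  have hb0 : b * b' ≠ 0 := by intro h; simp [h] at hb
  set α := taylorCoeff 1 r + taylorCoeff 1 s with hα
  set G : ℂ → ℂ := fun x => f x * g x - α * k x + deriv k x with hG
  -- the numerator of `G` over the denominator `x²`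
  set H : ℂ → ℂ := r * s - id * (fun x => α * t x) - (t - id * deriv t) with hH
  have hαt : AnalyticAt ℂ (fun x => α * t x) 0 := analyticAt_const.mul hk.reg
  have h1 : AnalyticAt ℂ (r * s) 0 := hf.reg.mul hg.reg
  have h2 : AnalyticAt ℂ (id * (fun x => α * t x)) 0 := analyticAt_id.mul hαt
  have h3 : AnalyticAt ℂ (id * deriv t) 0 := analyticAt_id.mul hk.reg.deriv
  have hHan : AnalyticAt ℂ H 0 := (h1.sub h2).sub (hk.reg.sub h3)
  have hcoeff : ∀ m, taylorCoeff (m + 1) H =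
      ∑ p ∈ Finset.HasAntidiagonal.antidiagonal (m + 1), taylorCoeff p.1 r * taylorCoeff p.2 s
        - (α * taylorCoeff m t - m * taylorCoeff (m + 1) t) := by
    intro m
    rw [hH, taylorCoeff_sub (h1.sub h2) (hk.reg.sub h3), taylorCoeff_sub h1 h2,
      taylorCoeff_sub hk.reg h3, taylorCoeff_id_mul hαt, taylorCoeff_id_mul hk.reg.deriv,
      taylorCoeff_deriv, taylorCoeff_const_mul, taylorCoeff_mul hf.reg hg.reg]
    ring
  have hGH : ∀ᶠ x in 𝓝[≠] (0 : ℂ), G x = H x / x ^ 2 := by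
    filter_upwards [hf.eventually_eq, hg.eventually_eq, hk.eventually_eq, hk.eventually_deriv_eq,
      eventually_ne_zero_nhdsNE] with x e1 e2 e3 e4 hx
    simp only [hG, hH, e1, e2, e3, e4, Pi.sub_apply, Pi.mul_apply, id]
    field_simp; ring
  have hq : QuasiPeriodic τ (a * a') (b * b') G := by
    constructor
    · intro z
      simp only [hG, hf.quasi.add_one, hg.quasi.add_one, hk.quasi.add_one,
        hk.quasi.deriv.add_one]
      ring
    · intro z
      simp only [hG, hf.quasi.add_tau, hg.quasi.add_tau, hk.quasi.add_tau,
        hk.quasi.deriv.add_tau]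
      ring
  have hH0 : H 0 = 0 := by simp [hH, hf.reg_zero, hg.reg_zero, hk.reg_zero]
  have hH1 : deriv H 0 = 0 := by
    have := hcoeff 0
    rw [Finset.Nat.antidiagonal_succ] at this
    simp only [zero_add, taylorCoeff_one, taylorCoeff_zero, hk.reg_zero, hα,
      Finset.sum_cons, Finset.sum_map, Finset.Nat.antidiagonal_zero, Finset.sum_singleton,
      hf.reg_zero] at this
    rw [this]
    simp [taylorCoeff_zero, taylorCoeff_one, hg.reg_zero, add_comm]
  have h0 : ExtendsAt G 0 := by
    obtain ⟨H1, hH1an, hH10, hH1e⟩ := hHan.exists_eq_mul hH0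
    obtain ⟨H2, hH2an, -, hH2e⟩ := hH1an.exists_eq_mul (hH10.trans hH1)
    refine ⟨H2, hH2an, ?_⟩
    filter_upwards [hGH, eventually_ne_zero_nhdsNE] with x hx hx0
    rw [hx, hH1e, hH2e]; field_simp
  have hz := hq.eventually_eq_zero hτ ha hb hab fun z => by
    by_cases hz : z ∈ tauLattice τ
    · exact hq.extendsAt_lattice ha0 hb0 h0 hz
    · exact (((hf.analyticAt z hz).mul (hg.analyticAt z hz)).sub
        (analyticAt_const.mul (hk.analyticAt z hz)) |>.add (hk.analyticAt z hz).deriv).extendsAt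
  have hHz : H =ᶠ[𝓝 0] fun _ => 0 := by
    refine eventuallyEq_of_nhdsNE hH0 ?_
    filter_upwards [hz, hGH, eventually_ne_zero_nhdsNE] with x e1 e2 hx
    rw [e1] at e2
    exact (div_eq_zero_iff.1 e2.symm).resolve_right (pow_ne_zero 2 hx)
  have := hcoeff l
  rw [taylorCoeff_congr hHz, show taylorCoeff (l + 1) (fun _ : ℂ => (0 : ℂ)) = 0 by
    simp [taylorCoeff]] at this
  linear_combination -this

/-- The distribution relation `∑ⱼ fⱼ(N x) = N k(x)` for functions `fⱼ` whose multipliers run over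
the `N`-th roots of those of `k`, read off at each Taylor coefficient. At a point of `Λ/N` outside
`Λ` the poles on the left cancel because the multipliers sum to zero there. -/
theorem IsKronecker.distribution {ι : Type*} [Fintype ι] {τ a b : ℂ} {k t : ℂ → ℂ}
    {A B : ι → ℂ} {f r : ι → ℂ → ℂ} {N : ℕ} (hN : 0 < N) (hτ : 0 < τ.im)
    (hk : IsKronecker τ a b k t) (hf : ∀ j, IsKronecker τ (A j) (B j) (f j) (r j))
    (ha : ‖a‖ = 1) (hb : ‖b‖ = 1) (hab : ¬(a = 1 ∧ b = 1))
    (hA : ∀ j, A j ^ N = a) (hB : ∀ j, B j ^ N = b) (hcard : Fintype.card ι = N ^ 2)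
    (hsum : ∀ m n : ℤ, ¬((N : ℤ) ∣ m ∧ (N : ℤ) ∣ n) → ∑ j, A j ^ m * B j ^ n = 0) (m : ℕ) :
    ∑ j, taylorCoeff m (r j) = (N : ℂ) ^ (2 - m : ℤ) * taylorCoeff m t := by
  have hN0 : (N : ℂ) ≠ 0 := by exact_mod_cast hN.ne'
  have ha0 : a ≠ 0 := by intro h; simp [h] at ha
  have hb0 : b ≠ 0 := by intro h; simp [h] at hb
  have hA0 : ∀ j, A j ≠ 0 := fun j h => ha0 (by rw [← hA j, h, zero_pow hN.ne'])
  have hB0 : ∀ j, B j ≠ 0 := fun j h => hb0 (by rw [← hB j, h, zero_pow hN.ne'])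
  set G : ℂ → ℂ := fun x => ∑ j, f j (N * x) - N * k x with hG
  have hq : QuasiPeriodic τ a b G := by
    constructor
    · intro z
      have : ∀ j, f j (N * (z + 1)) = a * f j (N * z) := fun j => by
        have := (hf j).quasi.add_lattice (hA0 j) (hB0 j) N 0 (N * z)
        rw [zpow_natCast, hA, zpow_zero] at this
        rw [← mul_one a, ← this]; congr 1; push_cast; ring
      simp only [hG, this, hk.quasi.add_one, mul_sub, Finset.mul_sum]
      ring
    · intro z
      have : ∀ j, f j (N * (z + τ)) = b * f j (N * z) := fun j => by
        have := (hf j).quasi.add_lattice (hA0 j) (hB0 j) 0 N (N * z)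
        rw [zpow_natCast, hB, zpow_zero] at this
        rw [← one_mul b, ← this]; congr 1; push_cast; ring
      simp only [hG, this, hk.quasi.add_tau, mul_sub, Finset.mul_sum]
      ring
  have hfe : ∀ᶠ x in 𝓝[≠] (0 : ℂ), ∀ j, f j (N * x) = r j (N * x) / (N * x) :=
    eventually_all.2 fun j => (tendsto_mul_nhdsNE_zero hN0).eventually (hf j).eventually_eq
  have hran : ∀ j, AnalyticAt ℂ (fun x => r j (N * x)) 0 := fun j => by
    have h : AnalyticAt ℂ (r j) (N * 0) := by simpa using (hf j).reg
    exact h.fun_comp (f := fun x : ℂ => N * x) (by fun_prop)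
  set H : ℂ → ℂ := (fun x => ∑ j, r j (N * x)) - (fun x => (N : ℂ) ^ 2 * t x) with hH
  have hS : AnalyticAt ℂ (fun x => ∑ j, r j (N * x)) 0 :=
    Finset.analyticAt_fun_sum _ fun j _ => hran j
  have hT : AnalyticAt ℂ (fun x => (N : ℂ) ^ 2 * t x) 0 := analyticAt_const.mul hk.reg
  have hHan : AnalyticAt ℂ H 0 := hS.sub hT
  have hH0 : H 0 = 0 := by
    simp [hH, fun j => (hf j).reg_zero, hk.reg_zero, hcard]
  have hGH : ∀ᶠ x in 𝓝[≠] (0 : ℂ), G x = H x / (N * x) := by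
    filter_upwards [hfe, hk.eventually_eq, eventually_ne_zero_nhdsNE] with x e1 e2 hx
    simp only [hG, hH, e1, e2, Pi.sub_apply, ← Finset.sum_div]
    field_simp
  have h0 : ExtendsAt G 0 := by
    obtain ⟨h, hh, -, he⟩ := hHan.exists_eq_mul hH0
    refine ⟨fun x => h x / N, hh.div_const, ?_⟩
    filter_upwards [hGH, eventually_ne_zero_nhdsNE] with x hx hx0
    rw [hx, he]; field_simp
  have hext : ∀ z, ExtendsAt G z := by
    intro z
    by_cases hz : z ∈ tauLattice τ
    · exact hq.extendsAt_lattice ha0 hb0 h0 hz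
    by_cases hNz : (N : ℂ) * z ∈ tauLattice τ
    · obtain ⟨p, q, hpq⟩ := hNz
      have hdvd : ¬((N : ℤ) ∣ p ∧ (N : ℤ) ∣ q) := by
        rintro ⟨⟨p', rfl⟩, ⟨q', rfl⟩⟩
        refine hz ⟨p', q', mul_left_cancel₀ hN0 ?_⟩
        rw [hpq]; push_cast; ring
      have hLan : AnalyticAt ℂ (fun x => ∑ j, A j ^ p * B j ^ q * r j (N * x)) 0 :=
        Finset.analyticAt_fun_sum _ fun j _ => analyticAt_const.mul (hran j)
      obtain ⟨h, hh, -, he⟩ := hLan.exists_eq_mul (by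
        simp only [mul_zero, (hf _).reg_zero, mul_one]; exact hsum p q hdvd)
      have hh' : AnalyticAt ℂ h (z - z) := by simpa using hh
      refine ⟨fun x => h (x - z) / N - N * k x, ?_, ?_⟩
      · exact ((hh'.fun_comp (f := fun x => x - z) (by fun_prop)).div_const).sub
          (analyticAt_const.mul (hk.analyticAt z hz))
      · have e1 := eventually_nhdsNE_add (w := z) hfe
        have e2 := eventually_nhdsNE_add (w := z) eventually_ne_zero_nhdsNE
        rw [zero_add] at e1 e2
        filter_upwards [e1, e2] with x e1 e2
        have : ∀ j, f j (N * x) = A j ^ p * B j ^ q * (r j (N * (x - z)) / (N * (x - z))) := by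
          intro j
          rw [← e1 j, ← (hf j).quasi.add_lattice (hA0 j) (hB0 j), ← hpq]
          congr 1; ring
        have e3 := he (x - z)
        simp only [hG, this]
        congr 1
        rw [eq_div_iff hN0, Finset.sum_mul]
        refine mul_left_cancel₀ e2 ?_
        rw [← e3, Finset.mul_sum]
        refine Finset.sum_congr rfl fun j _ => ?_
        field_simp
    · refine AnalyticAt.extendsAt (AnalyticAt.sub ?_
        (analyticAt_const.mul (hk.analyticAt z hz)))
      exact Finset.analyticAt_fun_sum _ fun j _ =>
        ((hf j).analyticAt _ hNz).fun_comp (f := fun x : ℂ => N * x) (by fun_prop)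
  have hz := hq.eventually_eq_zero hτ ha hb hab hext
  have hHz : H =ᶠ[𝓝 0] fun _ => 0 := by
    refine eventuallyEq_of_nhdsNE hH0 ?_
    filter_upwards [hz, hGH, eventually_ne_zero_nhdsNE] with x e1 e2 hx
    rw [e1] at e2
    exact (div_eq_zero_iff.1 e2.symm).resolve_right (mul_ne_zero hN0 hx)
  have hcoeff : taylorCoeff m H = (N : ℂ) ^ m * ∑ j, taylorCoeff m (r j) -
      (N : ℂ) ^ 2 * taylorCoeff m t := by
    rw [hH, taylorCoeff_sub hS hT, taylorCoeff_const_mul, taylorCoeff_sum fun j _ => hran j,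
      Finset.mul_sum]
    simp only [taylorCoeff_comp_mul_left]
  rw [taylorCoeff_congr hHz, show taylorCoeff m (fun _ : ℂ => (0 : ℂ)) = 0 by
    rcases m with _ | m <;> simp [taylorCoeff]] at hcoeff
  rw [zpow_sub₀ hN0, zpow_natCast, div_mul_eq_mul_div, eq_div_iff (pow_ne_zero m hN0)]
  have : (N : ℂ) ^ (2 : ℤ) = (N : ℂ) ^ 2 := by norm_cast
  rw [this]
  linear_combination -hcoeff

/-! ### Elliptic Bernoulli functions -/

lemma neg_add_mul_mem_tauLattice {τ : ℂ} (hτ : 0 < τ.im) {v : Fin 2 → ℝ}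
    (hv : v ∉ integerPoints) : -(v 0 : ℂ) + (v 1 : ℂ) * τ ∉ tauLattice τ := by
  rintro ⟨m, n, h⟩
  have him := congrArg Complex.im h
  have hre := congrArg Complex.re h
  simp only [add_im, neg_im, ofReal_im, neg_zero, mul_im, ofReal_re, zero_mul, add_zero,
    zero_add, intCast_im, intCast_re, add_re, neg_re, mul_re, sub_zero] at him hre
  have h1 : v 1 = n := mul_right_cancel₀ hτ.ne' him
  refine hv ⟨![-m, n], fun i => ?_⟩
  fin_cases i
  · simp only [Fin.zero_eta, Fin.isValue, Matrix.cons_val_zero, Int.cast_neg]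
    rw [h1] at hre
    linarith
  · simpa using h1

lemma not_multipliers_eq_one {v : Fin 2 → ℝ} (hv : v ∉ integerPoints) :
    ¬(cexpTwoPiI (v 1 : ℂ) = 1 ∧ cexpTwoPiI (v 0 : ℂ) = 1) := by
  rintro ⟨h1, h0⟩
  obtain ⟨m, hm⟩ := cexpTwoPiI_eq_one_iff.1 h1
  obtain ⟨n, hn⟩ := cexpTwoPiI_eq_one_iff.1 h0
  refine hv ⟨![n, m], fun i => ?_⟩
  fin_cases i
  · simpa using (by exact_mod_cast hn : v 0 = n)
  · simpa using (by exact_mod_cast hm : v 1 = m)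

theorem isKronecker_kroneckerF {τ : ℂ} (hτ : 0 < τ.im) {v : Fin 2 → ℝ} (hv : v ∉ integerPoints) :
    IsKronecker τ (cexpTwoPiI (v 1 : ℂ)) (cexpTwoPiI (v 0 : ℂ)) (fun X => kroneckerF v X τ)
      (kroneckerFReg v τ) := by
  set w : ℂ := -(v 0 : ℂ) + (v 1 : ℂ) * τ with hw
  have hθ := differentiable_thetaJacobi hτ
  have hwne : thetaJacobi w τ ≠ 0 := thetaJacobi_ne_zero hτ (neg_add_mul_mem_tauLattice hτ hv)
  have hθ' := deriv_thetaJacobi_zero_ne_zero hτ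
  set c : ℂ := deriv (fun x : ℂ => thetaJacobi x τ) 0 with hc
  have hF : ∀ X, kroneckerF v X τ = cexpTwoPiI ((v 1 : ℂ) * X) *
      (c * thetaJacobi (w + X) τ / (thetaJacobi w τ * thetaJacobi X τ)) := fun X => rfl
  have hnum : Differentiable ℂ fun X => cexpTwoPiI ((v 1 : ℂ) * X) *
      (c * thetaJacobi (w + X) τ) :=
    (differentiable_cexpTwoPiI.comp (f := fun X : ℂ => (v 1 : ℂ) * X) (by fun_prop)).mul
      ((hθ.comp (f := fun X : ℂ => w + X) (by fun_prop)).const_mul c)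
  -- near the origin `θ(X) = X s(X)`, and cancelling `X` gives the regular part
  set r : ℂ → ℂ := fun X => cexpTwoPiI ((v 1 : ℂ) * X) * (c * thetaJacobi (w + X) τ) /
    (thetaJacobi w τ * dslope (fun x => thetaJacobi x τ) 0 X) with hr
  have hran : AnalyticAt ℂ r 0 := by
    refine (hnum.analyticAt 0).div (analyticAt_const.mul (hθ.analyticAt_dslope 0 0)) ?_
    rw [dslope_same]; exact mul_ne_zero hwne hθ'
  have hr0 : r 0 = 1 := by
    simp only [hr, mul_zero, cexpTwoPiI_zero, add_zero, dslope_same, one_mul]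
    rw [mul_comm, ← hc]; exact div_self (mul_ne_zero hwne hθ')
  have hXF : ∀ᶠ X in 𝓝[≠] (0 : ℂ), X * kroneckerF v X τ = r X := by
    filter_upwards [eventually_ne_zero_nhdsNE] with X hX
    simp only [hF, hr]
    rw [eq_mul_dslope (f := fun x => thetaJacobi x τ) (thetaJacobi_zero τ) X]
    field_simp
  have hlim : Tendsto (fun X => X * kroneckerF v X τ) (𝓝[≠] 0) (𝓝 1) := by
    rw [← hr0]
    exact (hran.continuousAt.tendsto.mono_left nhdsWithin_le_nhds).congr'
      (hXF.mono fun _ h => h.symm)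
  have hreg0 : kroneckerFReg v τ 0 = 1 := by
    simp [kroneckerFReg, hlim.limUnder_eq]
  have hreg : ∀ X, X ≠ 0 → kroneckerFReg v τ X = X * kroneckerF v X τ := fun X hX => by
    simp [kroneckerFReg, hX]
  refine ⟨fun z hz => ?_, ⟨fun z => ?_, fun z => ?_⟩, ?_, hreg0, ?_⟩
  · have : (fun X => kroneckerF v X τ) = fun X => cexpTwoPiI ((v 1 : ℂ) * X) *
      (c * thetaJacobi (w + X) τ) / (thetaJacobi w τ * thetaJacobi X τ) :=
      funext fun X => by rw [hF]; ring
    rw [this]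
    exact (hnum.analyticAt z).div (analyticAt_const.mul (hθ.analyticAt z))
      (mul_ne_zero hwne (thetaJacobi_ne_zero hτ hz))
  · simp only [hF]
    rw [← add_assoc, thetaJacobi_add_one, thetaJacobi_add_one, mul_add, mul_one, cexpTwoPiI_add]
    rw [mul_neg, mul_neg, neg_div_neg_eq]; ring
  · simp only [hF]
    have e1 : cexpTwoPiI (-τ / 2 - (w + z)) = cexpTwoPiI (-w) * cexpTwoPiI (-τ / 2 - z) := by
      rw [← cexpTwoPiI_add]; congr 1; ring
    have e2 : cexpTwoPiI (v 0 : ℂ) = cexpTwoPiI ((v 1 : ℂ) * τ) * cexpTwoPiI (-w) := by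
      rw [← cexpTwoPiI_add]; congr 1; rw [hw]; ring
    have e3 := cexpTwoPiI_ne_zero (-τ / 2 - z)
    rw [← add_assoc, thetaJacobi_add_tau, thetaJacobi_add_tau, mul_add, cexpTwoPiI_add, e1, e2]
    rw [show c * (-(cexpTwoPiI (-w) * cexpTwoPiI (-τ / 2 - z)) * thetaJacobi (w + z) τ) =
      -cexpTwoPiI (-τ / 2 - z) * (cexpTwoPiI (-w) * (c * thetaJacobi (w + z) τ)) by ring,
      show thetaJacobi w τ * (-cexpTwoPiI (-τ / 2 - z) * thetaJacobi z τ) =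
      -cexpTwoPiI (-τ / 2 - z) * (thetaJacobi w τ * thetaJacobi z τ) by ring,
      mul_div_mul_left _ _ (neg_ne_zero.2 e3)]
    ring
  · refine hran.congr ?_
    refine eventuallyEq_of_nhdsNE (by rw [hr0, hreg0]) ?_
    filter_upwards [hXF, eventually_ne_zero_nhdsNE] with X h hX
    rw [hreg X hX, h]
  · filter_upwards [eventually_ne_zero_nhdsNE] with X hX
    rw [hreg X hX]; field_simp

/-- The coefficients `β_m = (2πi)^m B_m / m!` of `X F(v;X;τ) = ∑ β_m X^m`. -/
noncomputable def bernoulliCoeff (τ : ℂ) (m : ℕ) (v : Fin 2 → ℝ) : ℂ :=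
  taylorCoeff m (kroneckerFReg v τ)

lemma ellipticBernoulli_eq (m : ℕ) (v : Fin 2 → ℝ) (τ : ℂ) :
    ellipticBernoulli m v τ = m.factorial / (2 * Real.pi * I) ^ m * bernoulliCoeff τ m v := by
  have : (m.factorial : ℂ) ≠ 0 := by exact_mod_cast m.factorial_ne_zero
  unfold ellipticBernoulli bernoulliCoeff taylorCoeff
  field_simp

lemma bernoulliCoeff_zero {τ : ℂ} (hτ : 0 < τ.im) {v : Fin 2 → ℝ} (hv : v ∉ integerPoints) :
    bernoulliCoeff τ 0 v = 1 := by
  rw [bernoulliCoeff, taylorCoeff_zero, (isKronecker_kroneckerF hτ hv).reg_zero]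

lemma cexpTwoPiI_add_int (x : ℝ) (n : ℤ) :
    cexpTwoPiI ((x + n : ℝ) : ℂ) = cexpTwoPiI (x : ℂ) := by
  push_cast
  rw [cexpTwoPiI_add, cexpTwoPiI_eq_one_iff.2 ⟨n, rfl⟩, mul_one]

lemma add_int_mem_integerPoints {v : Fin 2 → ℝ} {a : Fin 2 → ℤ}
    (h : (fun i => v i + a i) ∈ integerPoints) : v ∈ integerPoints := by
  obtain ⟨b, hb⟩ := h
  exact ⟨fun i => b i - a i, fun i => by push_cast; rw [← hb]; ring⟩

lemma bernoulliCoeff_add_int {τ : ℂ} (hτ : 0 < τ.im) {v : Fin 2 → ℝ} (hv : v ∉ integerPoints)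
    (a : Fin 2 → ℤ) (m : ℕ) :
    bernoulliCoeff τ m (fun i => v i + a i) = bernoulliCoeff τ m v := by
  have h1 := isKronecker_kroneckerF hτ (fun h => hv (add_int_mem_integerPoints (a := a) h))
  rw [cexpTwoPiI_add_int, cexpTwoPiI_add_int] at h1
  exact taylorCoeff_congr (h1.unique hτ (isKronecker_kroneckerF hτ hv)
    (norm_cexpTwoPiI_ofReal _) (norm_cexpTwoPiI_ofReal _) (not_multipliers_eq_one hv)) m

lemma neg_mem_integerPoints {v : Fin 2 → ℝ} (h : -v ∈ integerPoints) : v ∈ integerPoints := by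
  obtain ⟨b, hb⟩ := h
  exact ⟨fun i => -b i, fun i => by have := hb i; rw [Pi.neg_apply] at this; push_cast; linarith⟩

lemma bernoulliCoeff_neg {τ : ℂ} (hτ : 0 < τ.im) {v : Fin 2 → ℝ} (hv : v ∉ integerPoints)
    (m : ℕ) : bernoulliCoeff τ m (-v) = (-1) ^ m * bernoulliCoeff τ m v := by
  have hv' : -v ∉ integerPoints := fun h => hv (neg_mem_integerPoints h)
  have h1 := (isKronecker_kroneckerF hτ hv).neg (cexpTwoPiI_ne_zero _) (cexpTwoPiI_ne_zero _)
  rw [← cexpTwoPiI_neg, ← cexpTwoPiI_neg] at h1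
  have h2 := isKronecker_kroneckerF hτ hv'
  simp only [Pi.neg_apply, ofReal_neg] at h2
  have h3 := h2.unique hτ h1 (by simpa using norm_cexpTwoPiI_ofReal (-(v 1)))
    (by simpa using norm_cexpTwoPiI_ofReal (-(v 0)))
    (by simpa using not_multipliers_eq_one hv')
  rw [bernoulliCoeff, taylorCoeff_congr h3, taylorCoeff_comp_mul_left, bernoulliCoeff]

theorem bernoulliCoeff_fay {τ : ℂ} (hτ : 0 < τ.im) {v w : Fin 2 → ℝ} (hv : v ∉ integerPoints)
    (hw : w ∉ integerPoints) (hvw : v + w ∉ integerPoints) (l : ℕ) :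
    ∑ p ∈ Finset.HasAntidiagonal.antidiagonal (l + 1),
        bernoulliCoeff τ p.1 v * bernoulliCoeff τ p.2 w =
      (bernoulliCoeff τ 1 v + bernoulliCoeff τ 1 w) * bernoulliCoeff τ l (v + w) -
        l * bernoulliCoeff τ (l + 1) (v + w) := by
  have hk := isKronecker_kroneckerF hτ hvw
  have e : ∀ i, cexpTwoPiI (((v + w) i : ℝ) : ℂ) = cexpTwoPiI (v i) * cexpTwoPiI (w i) := by
    intro i; rw [← cexpTwoPiI_add]; simp
  have h1 := norm_cexpTwoPiI_ofReal ((v + w) 1)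
  have h0 := norm_cexpTwoPiI_ofReal ((v + w) 0)
  have hne := not_multipliers_eq_one hvw
  rw [e, e] at hk
  rw [e] at h1 h0
  rw [e, e] at hne
  exact (isKronecker_kroneckerF hτ hv).fay hτ (isKronecker_kroneckerF hτ hw) hk h1 h0 hne l

lemma sum_cexpTwoPiI_eq_zero {N : ℕ} (hN : 0 < N) (x : ℝ) {m : ℤ} (hm : ¬(N : ℤ) ∣ m) :
    ∑ j : Fin N, cexpTwoPiI ((((j : ℕ) + x) / N : ℝ) : ℂ) ^ m = 0 := by
  have hN0 : (N : ℂ) ≠ 0 := by exact_mod_cast hN.ne'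
  set ζ : ℂ := cexpTwoPiI (m / N) with hζ
  have hζN : ζ ^ N = 1 := by
    rw [hζ, ← cexpTwoPiI_nat_mul, cexpTwoPiI_eq_one_iff]
    exact ⟨m, by field_simp⟩
  have hζ1 : ζ ≠ 1 := by
    rw [hζ, Ne, cexpTwoPiI_eq_one_iff]
    rintro ⟨n, hn⟩
    rw [div_eq_iff hN0] at hn
    exact hm ⟨n, by rw [mul_comm]; exact_mod_cast hn⟩
  have hterm : ∀ j : Fin N, cexpTwoPiI ((((j : ℕ) + x) / N : ℝ) : ℂ) ^ m =
      cexpTwoPiI (m * x / N) * ζ ^ (j : ℕ) := by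
    intro j
    rw [hζ, ← cexpTwoPiI_nat_mul, ← cexpTwoPiI_add]
    unfold cexpTwoPiI
    rw [← Complex.exp_int_mul]; congr 1; push_cast; ring
  rw [Finset.sum_congr rfl fun j _ => hterm j, ← Finset.mul_sum,
    Fin.sum_univ_eq_sum_range (fun j => ζ ^ j) N, geom_sum_eq hζ1, hζN, sub_self, zero_div,
    mul_zero]

theorem sum_bernoulliCoeff_div {τ : ℂ} (hτ : 0 < τ.im) {N : ℕ} (hN : 0 < N) {v : Fin 2 → ℝ}
    (hv : v ∉ integerPoints) (m : ℕ) :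
    ∑ j : Fin 2 → Fin N, bernoulliCoeff τ m (fun i => ((j i : ℕ) + v i) / N) =
      (N : ℂ) ^ (2 - m : ℤ) * bernoulliCoeff τ m v := by
  have hN0 : (N : ℝ) ≠ 0 := by exact_mod_cast hN.ne'
  have hmem : ∀ j : Fin 2 → Fin N, (fun i => (((j i : ℕ) + v i) / N : ℝ)) ∉ integerPoints := by
    rintro j ⟨b, hb⟩
    refine hv ⟨fun i => N * b i - (j i : ℕ), fun i => ?_⟩
    have := hb i
    rw [div_eq_iff hN0] at this
    push_cast; linarith
  have hpow : ∀ (j : Fin 2 → Fin N) (i : Fin 2),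
      cexpTwoPiI ((((j i : ℕ) + v i) / N : ℝ) : ℂ) ^ N = cexpTwoPiI (v i : ℂ) := by
    intro j i
    rw [← cexpTwoPiI_nat_mul, ← cexpTwoPiI_add_int (v i) (j i : ℕ)]
    congr 1
    have : (N : ℂ) ≠ 0 := by exact_mod_cast hN.ne'
    push_cast; field_simp; ring
  refine (isKronecker_kroneckerF hτ hv).distribution hN hτ
    (fun j => isKronecker_kroneckerF hτ (hmem j)) (norm_cexpTwoPiI_ofReal _)
    (norm_cexpTwoPiI_ofReal _) (not_multipliers_eq_one hv) (fun j => hpow j 1)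
    (fun j => hpow j 0) (by simp) (fun p q hpq => ?_) m
  have hprod : ∑ j : Fin 2 → Fin N, cexpTwoPiI ((((j 1 : ℕ) + v 1) / N : ℝ) : ℂ) ^ p *
        cexpTwoPiI ((((j 0 : ℕ) + v 0) / N : ℝ) : ℂ) ^ q =
      (∑ j : Fin N, cexpTwoPiI ((((j : ℕ) + v 0) / N : ℝ) : ℂ) ^ q) *
        ∑ j : Fin N, cexpTwoPiI ((((j : ℕ) + v 1) / N : ℝ) : ℂ) ^ p := by
    rw [Finset.sum_mul_sum, ← Fintype.sum_prod_type', ← (finTwoArrowEquiv (Fin N)).sum_comp]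
    refine Finset.sum_congr rfl fun j _ => ?_
    rw [mul_comm]; rfl
  rw [hprod]
  by_cases hp : (N : ℤ) ∣ p
  · rw [sum_cexpTwoPiI_eq_zero hN (v 0) (fun h => hpq ⟨hp, h⟩), zero_mul]
  · rw [sum_cexpTwoPiI_eq_zero hN (v 1) hp, mul_zero]

/-! ### Division points on the real torus -/

/-- The torus `(ℝ/ℤ)²`. -/
abbrev RealTorus : Type := Fin 2 → AddCircle (1 : ℝ)

/-- The projection `ℝ² → (ℝ/ℤ)²`. -/
def toTorus (v : Fin 2 → ℝ) : RealTorus := fun i => (v i : AddCircle (1 : ℝ))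

lemma toTorus_eq_iff {v w : Fin 2 → ℝ} :
    toTorus v = toTorus w ↔ ∃ a : Fin 2 → ℤ, ∀ i, v i = w i + a i := by
  rw [← Classical.skolem (p := fun i (n : ℤ) => v i = w i + n), funext_iff]
  refine forall_congr' fun i => ?_
  unfold toTorus
  rw [← sub_eq_zero, ← AddCircle.coe_sub, AddCircle.coe_eq_zero_iff]
  refine exists_congr fun n => ?_
  rw [zsmul_eq_mul, mul_one]
  constructor <;> intro h <;> linarith

lemma toTorus_eq_zero_iff {v : Fin 2 → ℝ} : toTorus v = 0 ↔ v ∈ integerPoints := by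
  rw [show (0 : RealTorus) = toTorus 0 by ext i; simp [toTorus], toTorus_eq_iff]
  simp [integerPoints]

lemma toTorus_surjective : Function.Surjective toTorus := fun t =>
  ⟨fun i => (QuotientAddGroup.mk_surjective (t i)).choose,
    funext fun i => (QuotientAddGroup.mk_surjective (t i)).choose_spec⟩

lemma toTorus_neg (v : Fin 2 → ℝ) : toTorus (-v) = -toTorus v := by
  ext i; simp [toTorus]

lemma toTorus_add (v w : Fin 2 → ℝ) : toTorus (v + w) = toTorus v + toTorus w := by
  ext i; simp [toTorus]

lemma zsmul_toTorus (n : ℤ) (v : Fin 2 → ℝ) : n • toTorus v = toTorus fun i => n * v i := by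
  ext i
  simp only [toTorus, Pi.smul_apply]
  rw [← AddCircle.coe_zsmul, zsmul_eq_mul]

open Classical in
/-- The finite set of points `z` of the torus with `N z = w`, for `N ≠ 0`. -/
noncomputable def divisionPoints (N : ℤ) (w : RealTorus) : Finset RealTorus :=
  if h : {z : RealTorus | N • z = w}.Finite then h.toFinset else ∅

lemma exists_eq_toTorus_div {N : ℕ} (hN : 0 < N) {v : Fin 2 → ℝ} {z : RealTorus}
    (hz : (N : ℤ) • z = toTorus v) :
    ∃ j : Fin 2 → Fin N, toTorus (fun i => ((j i : ℕ) + v i) / N) = z := by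
  have hN0 : (N : ℝ) ≠ 0 := by exact_mod_cast hN.ne'
  have hNz : (N : ℤ) ≠ 0 := by exact_mod_cast hN.ne'
  obtain ⟨u, rfl⟩ := toTorus_surjective z
  rw [zsmul_toTorus, toTorus_eq_iff] at hz
  obtain ⟨k, hk⟩ := hz
  have hlt : ∀ i, (k i % N).toNat < N := fun i => by
    have h1 := Int.emod_lt_of_pos (k i) (by omega : (0 : ℤ) < N)
    have h2 := Int.emod_nonneg (k i) hNz
    omega
  refine ⟨fun i => ⟨(k i % N).toNat, hlt i⟩, ?_⟩
  rw [toTorus_eq_iff]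
  refine ⟨fun i => -(k i / N), fun i => ?_⟩
  have h2 := Int.toNat_of_nonneg (Int.emod_nonneg (k i) hNz)
  have h3 := Int.emod_add_mul_ediv (k i) N
  have h4 : (((k i % N).toNat : ℕ) : ℝ) = k i - N * (k i / N : ℤ) := by
    have : (((k i % N).toNat : ℤ)) = k i - N * (k i / N) := by rw [h2]; linarith
    exact_mod_cast this
  have h5 := hk i
  simp only [h4]
  push_cast at h5 ⊢
  field_simp
  linarith

lemma zsmul_toTorus_div {N : ℕ} (hN : 0 < N) (v : Fin 2 → ℝ) (j : Fin 2 → Fin N) :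
    (N : ℤ) • toTorus (fun i => ((j i : ℕ) + v i) / N) = toTorus v := by
  have hN0 : (N : ℝ) ≠ 0 := by exact_mod_cast hN.ne'
  rw [zsmul_toTorus, toTorus_eq_iff]
  refine ⟨fun i => (j i : ℕ), fun i => ?_⟩
  push_cast; field_simp; ring

lemma finite_divisionPoints {N : ℤ} (hN : N ≠ 0) (w : RealTorus) :
    {z : RealTorus | N • z = w}.Finite := by
  wlog hpos : 0 < N generalizing N w
  · have := this (neg_ne_zero.2 hN) (-w) (by omega)
    simpa using this
  lift N to ℕ using hpos.le
  obtain ⟨v, rfl⟩ := toTorus_surjective w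
  have hN' : 0 < N := by exact_mod_cast hpos
  refine (Set.finite_range fun j : Fin 2 → Fin N =>
    toTorus fun i => ((j i : ℕ) + v i) / N).subset fun z hz => ?_
  exact exists_eq_toTorus_div hN' hz

lemma mem_divisionPoints {N : ℤ} (hN : N ≠ 0) {w z : RealTorus} :
    z ∈ divisionPoints N w ↔ N • z = w := by
  rw [divisionPoints, dif_pos (finite_divisionPoints hN w)]; simp

lemma divisionPoints_neg {N : ℤ} (hN : N ≠ 0) (w : RealTorus) :
    divisionPoints (-N) (-w) = divisionPoints N w := by
  ext z
  rw [mem_divisionPoints hN, mem_divisionPoints (neg_ne_zero.2 hN)]; simp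

lemma sum_divisionPoints_toTorus {N : ℕ} (hN : 0 < N) (v : Fin 2 → ℝ) (g : RealTorus → ℂ) :
    ∑ z ∈ divisionPoints N (toTorus v), g z =
      ∑ j : Fin 2 → Fin N, g (toTorus fun i => ((j i : ℕ) + v i) / N) := by
  have hNz : (N : ℤ) ≠ 0 := by exact_mod_cast hN.ne'
  have hN0 : (N : ℝ) ≠ 0 := by exact_mod_cast hN.ne'
  symm
  refine Finset.sum_bij (fun j _ => toTorus fun i => ((j i : ℕ) + v i) / N) ?_ ?_ ?_ ?_
  · intro j _
    exact (mem_divisionPoints hNz).2 (zsmul_toTorus_div hN v j)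
  · intro j _ k _ hjk
    obtain ⟨a, ha⟩ := toTorus_eq_iff.1 hjk
    ext i
    have h1 := ha i
    field_simp at h1
    have h2 : ((j i : ℕ) : ℤ) = (k i : ℕ) + N * a i := by
      have : ((j i : ℕ) : ℝ) = (k i : ℕ) + N * a i := by linarith
      exact_mod_cast this
    have h3 := (j i).2
    have h4 := (k i).2
    have h5 : a i = 0 := by
      by_contra h
      rcases lt_or_gt_of_ne h with h | h
      · nlinarith
      · nlinarith
    rw [h5] at h2; omega
  · intro z hz
    obtain ⟨j, hj⟩ := exists_eq_toTorus_div hN ((mem_divisionPoints hNz).1 hz)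
    exact ⟨j, Finset.mem_univ _, hj⟩
  · intro j _; rfl

/-- Division by `M N` is carried out in two steps, first by `N` and then by `M`. -/
lemma sum_divisionPoints_mul {M N : ℤ} (hM : M ≠ 0) (hN : N ≠ 0) (w : RealTorus)
    (g : RealTorus → RealTorus → ℂ) :
    ∑ z ∈ divisionPoints (M * N) w, g z (M • z) =
      ∑ t ∈ divisionPoints N w, ∑ z ∈ divisionPoints M t, g z t := by
  classical
  have hmap : ∀ z ∈ divisionPoints (M * N) w, M • z ∈ divisionPoints N w := by
    intro z hz
    rw [mem_divisionPoints (mul_ne_zero hM hN)] at hz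
    rw [mem_divisionPoints hN, ← mul_smul, mul_comm, hz]
  rw [← Finset.sum_fiberwise_of_maps_to hmap]
  refine Finset.sum_congr rfl fun t ht => ?_
  rw [mem_divisionPoints hN] at ht
  have : (divisionPoints (M * N) w).filter (fun z => M • z = t) = divisionPoints M t := by
    ext z
    rw [Finset.mem_filter, mem_divisionPoints (mul_ne_zero hM hN), mem_divisionPoints hM]
    refine ⟨fun h => h.2, fun h => ⟨?_, h⟩⟩
    rw [mul_comm, mul_smul, h, ht]
  rw [this]
  refine Finset.sum_congr rfl fun z hz => ?_
  rw [(mem_divisionPoints hM).1 hz]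

lemma sum_divisionPoints_add {N : ℤ} (hN : N ≠ 0) (w s : RealTorus) (g : RealTorus → ℂ) :
    ∑ z ∈ divisionPoints N w, g (z + s) = ∑ z ∈ divisionPoints N (w + N • s), g z := by
  refine Finset.sum_bij' (fun z _ => z + s) (fun z _ => z - s) ?_ ?_ ?_ ?_ ?_
  · intro z hz
    rw [mem_divisionPoints hN] at *
    rw [smul_add, hz]
  · intro z hz
    rw [mem_divisionPoints hN] at *
    rw [smul_sub, hz]; simp
  · intro z _; simp
  · intro z _; simp
  · intro z _; rfl

/-- For coprime `p` and `q` the map `t ↦ p t - x` is a bijection from the solutions of `q t = y` to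
those of `q s = p y - q x`. -/
lemma sum_divisionPoints_coprime {p q : ℤ} (hpq : IsCoprime p q) (hq : q ≠ 0) (x y : RealTorus)
    (g : RealTorus → ℂ) :
    ∑ t ∈ divisionPoints q y, g (p • t - x) = ∑ s ∈ divisionPoints q (p • y - q • x), g s := by
  obtain ⟨u, v, huv⟩ := hpq
  have hz : ∀ z : RealTorus, u • p • z + v • q • z = z := fun z => by
    rw [← mul_smul, ← mul_smul, ← add_smul, huv, one_smul]
  refine Finset.sum_bij' (fun t _ => p • t - x) (fun s _ => u • (s + x) + v • y) ?_ ?_ ?_ ?_ ?_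
  · intro t ht
    rw [mem_divisionPoints hq] at *
    rw [← ht]; module
  · intro s hs
    rw [mem_divisionPoints hq] at *
    have : q • (s + x) = p • y := by rw [smul_add, hs]; simp
    calc q • (u • (s + x) + v • y) = u • q • (s + x) + v • q • y := by module
      _ = y := by rw [this, hz]
  · intro t ht
    rw [mem_divisionPoints hq] at ht
    rw [← ht, sub_add_cancel, hz]
  · intro s hs
    rw [mem_divisionPoints hq] at hs
    have : p • y = q • (s + x) := by rw [smul_add, hs]; simp
    calc p • (u • (s + x) + v • y) - x = u • p • (s + x) + v • p • y - x := by module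
      _ = s := by rw [this, hz]; simp
  · intro t _; rfl

/-- The coefficients `β_m = (2πi)^m B_m / m!` as functions on the torus. -/
noncomputable def torusCoeff (τ : ℂ) (m : ℕ) (t : RealTorus) : ℂ :=
  bernoulliCoeff τ m (toTorus_surjective t).choose

lemma torusCoeff_toTorus {τ : ℂ} (hτ : 0 < τ.im) {v : Fin 2 → ℝ} (hv : v ∉ integerPoints)
    (m : ℕ) : torusCoeff τ m (toTorus v) = bernoulliCoeff τ m v := by
  obtain ⟨a, ha⟩ := toTorus_eq_iff.1 (toTorus_surjective (toTorus v)).choose_spec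
  rw [torusCoeff, funext ha, bernoulliCoeff_add_int hτ hv]

lemma torusCoeff_zero {τ : ℂ} (hτ : 0 < τ.im) {t : RealTorus} (ht : t ≠ 0) :
    torusCoeff τ 0 t = 1 := by
  obtain ⟨v, rfl⟩ := toTorus_surjective t
  rw [Ne, toTorus_eq_zero_iff] at ht
  rw [torusCoeff_toTorus hτ ht, bernoulliCoeff_zero hτ ht]

lemma torusCoeff_neg {τ : ℂ} (hτ : 0 < τ.im) {t : RealTorus} (ht : t ≠ 0) (m : ℕ) :
    torusCoeff τ m (-t) = (-1) ^ m * torusCoeff τ m t := by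
  obtain ⟨v, rfl⟩ := toTorus_surjective t
  rw [Ne, toTorus_eq_zero_iff] at ht
  rw [← toTorus_neg, torusCoeff_toTorus hτ ht, torusCoeff_toTorus hτ
    (fun h => ht (neg_mem_integerPoints h)), bernoulliCoeff_neg hτ ht]

lemma torusCoeff_fay {τ : ℂ} (hτ : 0 < τ.im) {z w : RealTorus} (hz : z ≠ 0) (hw : w ≠ 0)
    (hzw : z + w ≠ 0) (l : ℕ) :
    ∑ p ∈ Finset.HasAntidiagonal.antidiagonal (l + 1),
        torusCoeff τ p.1 z * torusCoeff τ p.2 w =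
      (torusCoeff τ 1 z + torusCoeff τ 1 w) * torusCoeff τ l (z + w) -
        l * torusCoeff τ (l + 1) (z + w) := by
  obtain ⟨u, rfl⟩ := toTorus_surjective z
  obtain ⟨v, rfl⟩ := toTorus_surjective w
  rw [← toTorus_add] at hzw ⊢
  rw [Ne, toTorus_eq_zero_iff] at hz hw hzw
  simp only [torusCoeff_toTorus hτ hz, torusCoeff_toTorus hτ hw, torusCoeff_toTorus hτ hzw]
  exact bernoulliCoeff_fay hτ hz hw hzw l

/-- The distribution relation on the torus. For negative `N` it includes the parity of `β_m`. -/
theorem sum_torusCoeff {τ : ℂ} (hτ : 0 < τ.im) {N : ℤ} (hN : N ≠ 0) {w : RealTorus} (hw : w ≠ 0)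
    (m : ℕ) : ∑ z ∈ divisionPoints N w, torusCoeff τ m z =
      (N : ℂ) ^ (2 - m : ℤ) * torusCoeff τ m w := by
  wlog hpos : 0 < N generalizing N w
  · have h := this (neg_ne_zero.2 hN) (neg_ne_zero.2 hw) (by omega)
    rw [divisionPoints_neg hN, torusCoeff_neg hτ hw] at h
    rw [h, ← mul_assoc]
    congr 1
    have hs : ((-1 : ℂ) ^ (2 - m : ℤ)) * (-1) ^ m = 1 := by
      rw [← zpow_natCast, ← zpow_add₀ (by norm_num)]
      simp
    rw [show ((-N : ℤ) : ℂ) = -1 * N by push_cast; ring, mul_zpow]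
    linear_combination (N : ℂ) ^ (2 - m : ℤ) * hs
  lift N to ℕ using hpos.le
  have hN' : 0 < N := by exact_mod_cast hpos
  obtain ⟨v, rfl⟩ := toTorus_surjective w
  have hv := hw
  rw [Ne, toTorus_eq_zero_iff] at hv
  rw [sum_divisionPoints_toTorus hN', torusCoeff_toTorus hτ hv, Int.cast_natCast,
    ← sum_bernoulliCoeff_div hτ hN' hv]
  refine Finset.sum_congr rfl fun j _ => torusCoeff_toTorus hτ (fun h => hw ?_) m
  rw [← zsmul_toTorus_div hN' v j, toTorus_eq_zero_iff.2 h, smul_zero]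

/-! ### The three-term relation on the torus -/

/-- The two descriptions of the set of pairs `(z₁, z₂)` over which Fay's identity is summed. -/
lemma pair_conditions_iff {a b c d p q : ℤ} (hdet : a * d - b * c = 1) {x y z₁ z₂ : RealTorus} :
    ((q * c) • z₂ = y ∧ (c * p + d * q) • z₁ = -x - (q * d) • z₂) ↔
      ((-c * (c * p + d * q)) • z₁ = c • x + d • y ∧
        q • z₂ = -(a • x + b • y) - (a * (c * p + d * q)) • z₁) := by
  have hone : ∀ z : RealTorus, (a * d) • z - (b * c) • z = z := fun z => by
    rw [← sub_smul, hdet, one_smul]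
  constructor
  · rintro ⟨h1, h2⟩
    constructor
    · rw [← h1, mul_smul, h2]; module
    · have h3 : (q * d) • z₂ = -x - (c * p + d * q) • z₁ := by rw [h2]; module
      calc q • z₂ = (a * d) • q • z₂ - (b * c) • q • z₂ := (hone _).symm
        _ = a • ((q * d) • z₂) - b • ((q * c) • z₂) := by module
        _ = -(a • x + b • y) - (a * (c * p + d * q)) • z₁ := by rw [h1, h3]; module
  · rintro ⟨h1, h2⟩
    have h3 : (q * c) • z₂ = y := by
      calc (q * c) • z₂ = c • q • z₂ := by module
        _ = a • ((-c * (c * p + d * q)) • z₁) - c • (a • x + b • y) := by rw [h2]; module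
        _ = (a * d) • y - (b * c) • y := by rw [h1]; module
        _ = y := hone y
    refine ⟨h3, ?_⟩
    calc (c * p + d * q) • z₁
        = (a * d) • ((c * p + d * q) • z₁) - (b * c) • ((c * p + d * q) • z₁) := (hone _).symm
      _ = d • ((a * (c * p + d * q)) • z₁) + b • ((-c * (c * p + d * q)) • z₁) := by module
      _ = d • (-(a • x + b • y) - q • z₂) + b • (c • x + d • y) := by rw [h1, h2]; module
      _ = -((a * d) • x - (b * c) • x) - (q * d) • z₂ := by module
      _ = -x - (q * d) • z₂ := by rw [hone]

/-- The relation between the sums attached to `p/q`, to its image `(ap+bq)/(cp+dq)` and to `d/c`.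
It is Fay's identity summed over the pairs `(z₁, z₂)` of torsion translates described by
`pair_conditions_iff`; each of its terms involves only two of `z₁`, `z₂`, `z₁ + z₂` and is
simplified by the distribution relations. -/
theorem torus_relation {τ : ℂ} (hτ : 0 < τ.im) {a b c d p q : ℤ} (hdet : a * d - b * c = 1)
    (hpq : IsCoprime p q) (hq : q ≠ 0) (hc : c ≠ 0) (hQ : c * p + d * q ≠ 0)
    {x y : RealTorus} (hy : y ≠ 0) (hY : c • x + d • y ≠ 0) (hA : p • y - q • x ≠ 0) (l : ℕ) :
    ∑ e ∈ Finset.HasAntidiagonal.antidiagonal (l + 1),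
        ((c * p + d * q : ℤ) : ℂ) ^ (2 - e.1 : ℤ) * (q : ℂ) ^ (2 - e.2 : ℤ) *
          ∑ t ∈ divisionPoints c y, torusCoeff τ e.1 (-x - d • t) * torusCoeff τ e.2 t =
      ((c * p + d * q : ℤ) : ℂ) ^ (2 - l : ℤ) * c *
          ∑ t ∈ divisionPoints q y, torusCoeff τ 1 t * torusCoeff τ l (p • t - x) -
        c * (q : ℂ) ^ (2 - l : ℤ) *
          ∑ t ∈ divisionPoints (c * p + d * q) (c • x + d • y),
            torusCoeff τ 1 t * torusCoeff τ l ((a * p + b * q) • t - (a • x + b • y)) -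
        l * c ^ 2 * ((c * p + d * q : ℤ) : ℂ) ^ (1 - l : ℤ) * (q : ℂ) ^ (1 - l : ℤ) *
          torusCoeff τ (l + 1) (p • y - q • x) := by
  set Q : ℤ := c * p + d * q with hQdef
  set P : ℤ := a * p + b * q with hPdef
  set X : RealTorus := a • x + b • y with hX
  set Y : RealTorus := c • x + d • y with hYdef
  have hqc : q * c ≠ 0 := mul_ne_zero hq hc
  have hcQ : -c * Q ≠ 0 := mul_ne_zero (neg_ne_zero.2 hc) hQ
  -- the points at which coefficients are evaluated are not zero
  have n1 : ∀ t, c • t = y → -x - d • t ≠ 0 := fun t ht h => hY (by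
    have : x = -(d • t) := by rw [sub_eq_zero] at h; rw [← h, neg_neg]
    rw [hYdef, this, ← ht]; module)
  have n2 : ∀ t, q • t = y → p • t - x ≠ 0 := fun t ht h => hA (by
    rw [sub_eq_zero] at h
    rw [← h, ← ht]; module)
  have n3 : ∀ t, Q • t = Y → P • t - X ≠ 0 := fun t ht h => hA (by
    rw [sub_eq_zero] at h
    have e1 : P • Y - Q • X = 0 := by rw [← ht, ← h]; module
    have e2 : P • Y - Q • X = (a * d - b * c) • (p • y - q • x) := by
      rw [hPdef, hQdef, hYdef, hX]; module
    rw [e1, hdet, one_smul] at e2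
    exact e2.symm)
  -- the sum over all pairs, organised by `z₂` and by `z₁`
  have hpairs : ∀ Φ : RealTorus → RealTorus → ℂ,
      ∑ z₂ ∈ divisionPoints (q * c) y, ∑ z₁ ∈ divisionPoints Q (-x - (q * d) • z₂), Φ z₁ z₂ =
        ∑ z₁ ∈ divisionPoints (-c * Q) Y, ∑ z₂ ∈ divisionPoints q (-X - (a * Q) • z₁),
          Φ z₁ z₂ := by
    intro Φ
    refine Finset.sum_comm' fun z₂ z₁ => ?_
    rw [mem_divisionPoints hqc, mem_divisionPoints hQ, mem_divisionPoints hcQ,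
      mem_divisionPoints hq]
    exact (pair_conditions_iff hdet).trans and_comm
  have hshift : ∀ z₂ ∈ divisionPoints (q * c) y, ∀ g : RealTorus → ℂ,
      ∑ z₁ ∈ divisionPoints Q (-x - (q * d) • z₂), g (z₁ + z₂) =
        ∑ z ∈ divisionPoints Q (p • c • z₂ - x), g z := by
    intro z₂ _ g
    rw [sum_divisionPoints_add hQ]
    congr 2
    rw [hQdef]; module
  have hcz : ∀ z₂ ∈ divisionPoints (q * c) y, q • c • z₂ = y := fun z₂ h => by
    rw [mem_divisionPoints hqc, mul_smul] at h; exact h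
  have hqz : ∀ z₂ ∈ divisionPoints (q * c) y, c • q • z₂ = y := fun z₂ h => by
    rw [mem_divisionPoints hqc, mul_comm, mul_smul] at h; exact h
  have hprod : ∀ m n : ℕ,
      ∑ z₂ ∈ divisionPoints (q * c) y, ∑ z₁ ∈ divisionPoints Q (-x - (q * d) • z₂),
        torusCoeff τ m z₁ * torusCoeff τ n z₂ =
      (Q : ℂ) ^ (2 - m : ℤ) * (q : ℂ) ^ (2 - n : ℤ) *
        ∑ t ∈ divisionPoints c y, torusCoeff τ m (-x - d • t) * torusCoeff τ n t := by
    intro m n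
    calc _ = ∑ z₂ ∈ divisionPoints (q * c) y,
          (Q : ℂ) ^ (2 - m : ℤ) * torusCoeff τ m (-x - d • (q • z₂)) * torusCoeff τ n z₂ := by
          refine Finset.sum_congr rfl fun z₂ hz₂ => ?_
          have e : (q * d) • z₂ = d • q • z₂ := by module
          rw [← Finset.sum_mul, e, sum_torusCoeff hτ hQ (n1 _ (hqz z₂ hz₂))]
      _ = _ := by
          rw [sum_divisionPoints_mul hq hc y fun z t =>
            (Q : ℂ) ^ (2 - m : ℤ) * torusCoeff τ m (-x - d • t) * torusCoeff τ n z,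
            Finset.mul_sum]
          refine Finset.sum_congr rfl fun t ht => ?_
          rw [mem_divisionPoints hc] at ht
          rw [← Finset.mul_sum, sum_torusCoeff hτ hq (fun h => hy (by rw [← ht, h, smul_zero]))]
          ring
  have hsum : ∀ m n : ℕ,
      ∑ z₂ ∈ divisionPoints (q * c) y, ∑ z₁ ∈ divisionPoints Q (-x - (q * d) • z₂),
        torusCoeff τ m z₂ * torusCoeff τ n (z₁ + z₂) =
      (Q : ℂ) ^ (2 - n : ℤ) * (c : ℂ) ^ (2 - m : ℤ) *
        ∑ t ∈ divisionPoints q y, torusCoeff τ m t * torusCoeff τ n (p • t - x) := by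
    intro m n
    calc _ = ∑ z₂ ∈ divisionPoints (q * c) y,
          torusCoeff τ m z₂ * ((Q : ℂ) ^ (2 - n : ℤ) * torusCoeff τ n (p • (c • z₂) - x)) := by
          refine Finset.sum_congr rfl fun z₂ hz₂ => ?_
          rw [← Finset.mul_sum, hshift z₂ hz₂ (torusCoeff τ n),
            sum_torusCoeff hτ hQ (n2 _ (hcz z₂ hz₂))]
      _ = _ := by
          rw [mul_comm q c, sum_divisionPoints_mul hc hq y fun z t =>
            torusCoeff τ m z * ((Q : ℂ) ^ (2 - n : ℤ) * torusCoeff τ n (p • t - x)),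
            Finset.mul_sum]
          refine Finset.sum_congr rfl fun t ht => ?_
          rw [mem_divisionPoints hq] at ht
          rw [← Finset.sum_mul, sum_torusCoeff hτ hc (fun h => hy (by rw [← ht, h, smul_zero]))]
          ring
  have hsum' : ∑ z₂ ∈ divisionPoints (q * c) y, ∑ z₁ ∈ divisionPoints Q (-x - (q * d) • z₂),
        torusCoeff τ 1 z₁ * torusCoeff τ l (z₁ + z₂) =
      -(c : ℂ) * (q : ℂ) ^ (2 - l : ℤ) *
        ∑ t ∈ divisionPoints Q Y, torusCoeff τ 1 t * torusCoeff τ l (P • t - X) := by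
    have hmc : -c ≠ 0 := neg_ne_zero.2 hc
    calc _ = ∑ z₁ ∈ divisionPoints (-c * Q) Y,
          torusCoeff τ 1 z₁ * ((q : ℂ) ^ (2 - l : ℤ) * torusCoeff τ l (P • (-c • z₁) - X)) := by
          rw [hpairs]
          refine Finset.sum_congr rfl fun z₁ hz₁ => ?_
          have e : -X - (a * Q) • z₁ + q • z₁ = P • (-c • z₁) - X := by
            have : q = (a * d - b * c) * q := by rw [hdet, one_mul]
            rw [this, hQdef, hPdef]; module
          simp only [add_comm z₁]
          rw [← Finset.mul_sum, sum_divisionPoints_add hq _ _ (torusCoeff τ l), e,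
            sum_torusCoeff hτ hq (n3 _ ?_)]
          rw [mem_divisionPoints hcQ] at hz₁
          rw [← mul_smul, mul_comm, hz₁]
      _ = _ := by
          rw [sum_divisionPoints_mul hmc hQ Y fun z t =>
            torusCoeff τ 1 z * ((q : ℂ) ^ (2 - l : ℤ) * torusCoeff τ l (P • t - X)),
            Finset.mul_sum]
          refine Finset.sum_congr rfl fun t ht => ?_
          rw [mem_divisionPoints hQ] at ht
          rw [← Finset.sum_mul, sum_torusCoeff hτ hmc
            (fun h => hY (by rw [← ht, h, smul_zero]))]
          push_cast; norm_num; ring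
  have hlast : ∑ z₂ ∈ divisionPoints (q * c) y, ∑ z₁ ∈ divisionPoints Q (-x - (q * d) • z₂),
        torusCoeff τ (l + 1) (z₁ + z₂) =
      c ^ 2 * (Q : ℂ) ^ (1 - l : ℤ) * (q : ℂ) ^ (1 - l : ℤ) *
        torusCoeff τ (l + 1) (p • y - q • x) := by
    have e : ∀ z₂ ∈ divisionPoints (q * c) y, ∀ z₁ ∈ divisionPoints Q (-x - (q * d) • z₂),
        torusCoeff τ (l + 1) (z₁ + z₂) =
          torusCoeff τ 0 z₂ * torusCoeff τ (l + 1) (z₁ + z₂) := by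
      intro z₂ hz₂ z₁ _
      rw [torusCoeff_zero hτ (fun h => hy (by rw [← hqz z₂ hz₂, h, smul_zero, smul_zero])),
        one_mul]
    have hexp : (2 - (l + 1 : ℕ) : ℤ) = 1 - l := by push_cast; ring
    rw [Finset.sum_congr rfl fun z₂ hz₂ => Finset.sum_congr rfl (e z₂ hz₂), hsum 0 (l + 1)]
    have e' : ∀ t ∈ divisionPoints q y, torusCoeff τ 0 t * torusCoeff τ (l + 1) (p • t - x) =
        torusCoeff τ (l + 1) (p • t - x) := by
      intro t ht
      rw [mem_divisionPoints hq] at ht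
      rw [torusCoeff_zero hτ (fun h => hy (by rw [← ht, h, smul_zero])), one_mul]
    rw [Finset.sum_congr rfl e', sum_divisionPoints_coprime hpq hq, sum_torusCoeff hτ hq hA, hexp]
    norm_num; norm_cast; ring
  have hfay : ∀ z₂ ∈ divisionPoints (q * c) y, ∀ z₁ ∈ divisionPoints Q (-x - (q * d) • z₂),
      ∑ e ∈ Finset.HasAntidiagonal.antidiagonal (l + 1),
          torusCoeff τ e.1 z₁ * torusCoeff τ e.2 z₂ =
        torusCoeff τ 1 z₁ * torusCoeff τ l (z₁ + z₂) +
          torusCoeff τ 1 z₂ * torusCoeff τ l (z₁ + z₂) -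
            l * torusCoeff τ (l + 1) (z₁ + z₂) := by
    intro z₂ hz₂ z₁ hz₁
    have h2 := hcz z₂ hz₂
    have h3 := hqz z₂ hz₂
    rw [mem_divisionPoints hQ] at hz₁
    rw [torusCoeff_fay hτ, add_mul]
    · rintro rfl
      refine n1 _ h3 ?_
      rw [smul_zero] at hz₁
      rw [hz₁]; module
    · rintro rfl
      exact hy (by rw [← h2, smul_zero, smul_zero])
    · intro h
      refine n2 _ h2 ?_
      have e : Q • (z₁ + z₂) = p • c • z₂ - x := by
        rw [smul_add, hz₁, hQdef]; module
      rw [← e, h, smul_zero]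
  calc _ = ∑ e ∈ Finset.HasAntidiagonal.antidiagonal (l + 1),
        ∑ z₂ ∈ divisionPoints (q * c) y, ∑ z₁ ∈ divisionPoints Q (-x - (q * d) • z₂),
          torusCoeff τ e.1 z₁ * torusCoeff τ e.2 z₂ :=
        Finset.sum_congr rfl fun e _ => (hprod e.1 e.2).symm
    _ = ∑ z₂ ∈ divisionPoints (q * c) y, ∑ z₁ ∈ divisionPoints Q (-x - (q * d) • z₂),
          (torusCoeff τ 1 z₁ * torusCoeff τ l (z₁ + z₂) +
            torusCoeff τ 1 z₂ * torusCoeff τ l (z₁ + z₂) -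
              l * torusCoeff τ (l + 1) (z₁ + z₂)) := by
        rw [Finset.sum_comm]
        refine Finset.sum_congr rfl fun z₂ hz₂ => ?_
        rw [Finset.sum_comm]
        exact Finset.sum_congr rfl (hfay z₂ hz₂)
    _ = _ := by
        have e : ∑ z₂ ∈ divisionPoints (q * c) y, ∑ z₁ ∈ divisionPoints Q (-x - (q * d) • z₂),
            l * torusCoeff τ (l + 1) (z₁ + z₂) = l * ∑ z₂ ∈ divisionPoints (q * c) y,
              ∑ z₁ ∈ divisionPoints Q (-x - (q * d) • z₂), torusCoeff τ (l + 1) (z₁ + z₂) := by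
          simp only [Finset.mul_sum]
        simp only [Finset.sum_add_distrib, Finset.sum_sub_distrib]
        rw [hsum', hsum 1 l, e, hlast]
        norm_num; ring

/-! ### Elliptic Dedekind–Rademacher sums -/

lemma exists_num_den_eq {P Q : ℤ} (hQ : Q ≠ 0) (h : IsCoprime P Q) :
    ∃ ε : ℤ, (ε = 1 ∨ ε = -1) ∧ ((P : ℚ) / Q).num = ε * P ∧ (((P : ℚ) / Q).den : ℤ) = ε * Q := by
  rcases lt_or_gt_of_ne hQ with hneg | hpos
  · refine ⟨-1, Or.inr rfl, ?_⟩
    have hc : Nat.Coprime (-P).natAbs (-Q).natAbs := by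
      simpa using Int.isCoprime_iff_nat_coprime.1 h
    have h1 := Rat.num_div_eq_of_coprime (by omega : 0 < -Q) hc
    have h2 := Rat.den_div_eq_of_coprime (by omega : 0 < -Q) hc
    rw [show ((-P : ℤ) : ℚ) / ((-Q : ℤ) : ℚ) = P / Q by push_cast; rw [neg_div_neg_eq]] at h1 h2
    exact ⟨by rw [h1]; ring, by rw [h2]; ring⟩
  · have hc := Int.isCoprime_iff_nat_coprime.1 h
    exact ⟨1, Or.inl rfl, by rw [Rat.num_div_eq_of_coprime hpos hc]; ring,
      by rw [Rat.den_div_eq_of_coprime hpos hc]; ring⟩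

lemma toTorus_smul_add (m n : ℤ) (v w : Fin 2 → ℝ) :
    toTorus ((m : ℝ) • v + (n : ℝ) • w) = m • toTorus v + n • toTorus w := by
  rw [zsmul_toTorus, zsmul_toTorus, ← toTorus_add]; rfl

/-- The Dedekind–Rademacher sum as a sum over the points `t` of the torus with `q t = y`, in terms
of the coefficients `β_m`. -/
lemma dedekindRademacher_eq {τ : ℂ} (hτ : 0 < τ.im) {r : ℚ} {M : Matrix (Fin 2) (Fin 2) ℝ}
    (hy : toTorus (M 1) ≠ 0)
    (hxy : r.num • toTorus (M 1) - (r.den : ℤ) • toTorus (M 0) ≠ 0) (m n : ℕ) :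
    dedekindRademacher m n r M τ = m.factorial * n.factorial / (2 * Real.pi * I) ^ (m + n) *
      (1 / (r.den : ℂ) * ∑ t ∈ divisionPoints r.den (toTorus (M 1)),
        torusCoeff τ m t * torusCoeff τ n (r.num • t - toTorus (M 0))) := by
  unfold dedekindRademacher
  rw [sum_divisionPoints_toTorus r.den_pos, mul_left_comm]
  congr 1
  rw [Finset.mul_sum]
  refine Finset.sum_congr rfl fun j _ => ?_
  set t : Fin 2 → ℝ := fun i => ((j i : ℕ) + M 1 i) / r.den with ht
  have hden := zsmul_toTorus_div r.den_pos (M 1) j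
  have ht0 : t ∉ integerPoints := fun h => hy (by
    rw [← hden, toTorus_eq_zero_iff.2 h, smul_zero])
  have e : r.num • toTorus t - toTorus (M 0) = toTorus fun i => r.num * t i - M 0 i := by
    rw [zsmul_toTorus, sub_eq_add_neg, ← toTorus_neg, ← toTorus_add]; congr 1
  have hu0 : (fun i => r.num * t i - M 0 i) ∉ integerPoints := fun h => hxy (by
    have h1 : r.num • toTorus t = toTorus (M 0) := by
      rw [← sub_eq_zero, e, toTorus_eq_zero_iff]; exact h
    rw [← h1, ← hden]; module)
  change ellipticBernoulli m t τ * ellipticBernoulli n (fun i => r.num * t i - M 0 i) τ = _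
  rw [ellipticBernoulli_eq, ellipticBernoulli_eq, e, torusCoeff_toTorus hτ ht0,
    torusCoeff_toTorus hτ hu0, pow_add]
  ring

lemma sum_divisionPoints_neg {N : ℤ} (hN : N ≠ 0) (w : RealTorus) (g : RealTorus → ℂ) :
    ∑ z ∈ divisionPoints N w, g z = ∑ z ∈ divisionPoints N (-w), g (-z) := by
  refine Finset.sum_bij' (fun z _ => -z) (fun z _ => -z) ?_ ?_ ?_ ?_ ?_ <;>
    intro z hz <;> simp_all [mem_divisionPoints hN]

lemma dedekindRademacher_neg {τ : ℂ} (hτ : 0 < τ.im) {r : ℚ} {M : Matrix (Fin 2) (Fin 2) ℝ}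
    (hy : toTorus (M 1) ≠ 0)
    (hxy : r.num • toTorus (M 1) - (r.den : ℤ) • toTorus (M 0) ≠ 0) (m n : ℕ) :
    dedekindRademacher m n r (-M) τ = (-1) ^ (m + n) * dedekindRademacher m n r M τ := by
  have hden : (r.den : ℤ) ≠ 0 := by exact_mod_cast r.den_nz
  have e1 : toTorus ((-M) 1) = -toTorus (M 1) := toTorus_neg _
  have e0 : toTorus ((-M) 0) = -toTorus (M 0) := toTorus_neg _
  rw [dedekindRademacher_eq hτ hy hxy, dedekindRademacher_eq hτ (by rwa [e1, neg_ne_zero])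
    (by rw [e1, e0]; intro h; exact hxy (by rw [← neg_eq_zero, ← h]; module)), e1, e0,
    sum_divisionPoints_neg hden, neg_neg]
  suffices h : ∑ t ∈ divisionPoints r.den (toTorus (M 1)),
      torusCoeff τ m (-t) * torusCoeff τ n (r.num • -t - -toTorus (M 0)) =
      (-1) ^ (m + n) * ∑ t ∈ divisionPoints r.den (toTorus (M 1)),
        torusCoeff τ m t * torusCoeff τ n (r.num • t - toTorus (M 0)) by
    rw [h]; ring
  rw [Finset.mul_sum]
  refine Finset.sum_congr rfl fun t ht => ?_
  rw [mem_divisionPoints hden] at ht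
  have ht0 : t ≠ 0 := by rintro rfl; exact hy (by rw [← ht, smul_zero])
  have hu : r.num • t - toTorus (M 0) ≠ 0 := fun h => hxy (by
    rw [sub_eq_zero] at h
    rw [← h, ← ht]; module)
  rw [show r.num • -t - -toTorus (M 0) = -(r.num • t - toTorus (M 0)) by module,
    torusCoeff_neg hτ ht0, torusCoeff_neg hτ hu, pow_add]
  ring

/-- For `m = 1` the sum over division points may be written with any coprime fraction `P/Q`,
whatever the sign of `Q`. -/
lemma dedekindRademacher_one_eq {τ : ℂ} (hτ : 0 < τ.im) {P Q : ℤ} (hQ : Q ≠ 0)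
    (hcop : IsCoprime P Q) {M : Matrix (Fin 2) (Fin 2) ℝ} (hy : toTorus (M 1) ≠ 0)
    (hxy : P • toTorus (M 1) - Q • toTorus (M 0) ≠ 0) (n : ℕ) :
    dedekindRademacher 1 n ((P : ℚ) / Q) M τ = n.factorial / (2 * Real.pi * I) ^ (n + 1) *
      (1 / (Q : ℂ) * ∑ t ∈ divisionPoints Q (toTorus (M 1)),
        torusCoeff τ 1 t * torusCoeff τ n (P • t - toTorus (M 0))) := by
  obtain ⟨ε, hε, hnum, hden⟩ := exists_num_den_eq hQ hcop
  have hdenC : (((P : ℚ) / Q).den : ℂ) = ε * Q := by exact_mod_cast hden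
  rw [dedekindRademacher_eq hτ hy, hnum, hden, hdenC, add_comm 1 n, Nat.factorial_one,
    Nat.cast_one, one_mul]
  · congr 1
    rcases hε with rfl | rfl
    · simp
    · have hQ' : -Q ≠ 0 := neg_ne_zero.2 hQ
      have e : divisionPoints (-1 * Q) (toTorus (M 1)) = divisionPoints Q (-toTorus (M 1)) := by
        rw [← divisionPoints_neg hQ, neg_neg, neg_one_mul]
      rw [e, sum_divisionPoints_neg hQ, neg_neg]
      have e2 : ∀ t ∈ divisionPoints Q (toTorus (M 1)),
          torusCoeff τ 1 (-t) * torusCoeff τ n ((-1 * P) • -t - toTorus (M 0)) =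
            -(torusCoeff τ 1 t * torusCoeff τ n (P • t - toTorus (M 0))) := by
        intro t ht
        rw [mem_divisionPoints hQ] at ht
        have ht0 : t ≠ 0 := by rintro rfl; exact hy (by rw [← ht, smul_zero])
        rw [torusCoeff_neg hτ ht0, show (-1 * P) • -t = P • t by module]
        ring
      rw [Finset.sum_congr rfl e2, Finset.sum_neg_distrib]
      push_cast
      have : (Q : ℂ) ≠ 0 := by exact_mod_cast hQ
      field_simp
  · rw [hnum, hden]
    intro h
    refine hxy ?_
    rcases hε with rfl | rfl
    · simpa using h
    · rw [← neg_eq_zero, ← h]; module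

lemma det_entries (V : Matrix.SpecialLinearGroup (Fin 2) ℤ) :
    V 0 0 * V 1 1 - V 0 1 * V 1 0 = 1 := by
  have := V.det_coe
  rwa [Matrix.det_fin_two] at this

lemma isCoprime_bottom_row (V : Matrix.SpecialLinearGroup (Fin 2) ℤ) :
    IsCoprime (V 1 1) (V 1 0) := ⟨V 0 0, -V 0 1, by linear_combination det_entries V⟩

theorem matSetRat_eq_matSetSL (V : Matrix.SpecialLinearGroup (Fin 2) ℤ) (hc : V 1 0 ≠ 0) :
    matSetRat (-(V 1 1 : ℚ) / (V 1 0 : ℚ)) = matSetSL V := by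
  obtain ⟨ε, hε, hnum, hden⟩ := exists_num_den_eq hc (isCoprime_bottom_row V).neg_left
  rw [Int.cast_neg] at hnum hden
  ext M
  unfold matSetRat matSetSL
  simp only [Set.mem_ofPred_eq]
  refine and_congr_right fun _ => not_congr ?_
  have hd : (((-(V 1 1 : ℚ) / (V 1 0 : ℚ)).den : ℕ) : ℝ) = ε * V 1 0 := by exact_mod_cast hden
  rw [hnum, hd]
  have e : ((ε * V 1 0 : ℝ)) • M 0 - ((ε * -V 1 1 : ℤ) : ℝ) • M 1 =
      (ε : ℝ) • ((V 1 0 : ℝ) • M 0 + (V 1 1 : ℝ) • M 1) := by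
    push_cast; module
  rw [e]
  rcases hε with rfl | rfl
  · simp
  · simp only [Int.cast_neg, Int.cast_one, neg_smul, one_smul]
    exact ⟨neg_mem_integerPoints, fun h => neg_mem_integerPoints (by rwa [neg_neg])⟩

lemma mem_matSetSL_iff {V : Matrix.SpecialLinearGroup (Fin 2) ℤ}
    {M : Matrix (Fin 2) (Fin 2) ℝ} : M ∈ matSetSL V ↔
      toTorus (M 1) ≠ 0 ∧ V 1 0 • toTorus (M 0) + V 1 1 • toTorus (M 1) ≠ 0 := by
  rw [← toTorus_smul_add, Ne, Ne, toTorus_eq_zero_iff, toTorus_eq_zero_iff]; rfl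

lemma mem_matSetRat_iff {r : ℚ} {M : Matrix (Fin 2) (Fin 2) ℝ} : M ∈ matSetRat r ↔
      toTorus (M 1) ≠ 0 ∧ r.num • toTorus (M 1) - (r.den : ℤ) • toTorus (M 0) ≠ 0 := by
  have e : r.num • toTorus (M 1) - (r.den : ℤ) • toTorus (M 0) =
      -toTorus ((r.den : ℝ) • M 0 - (r.num : ℝ) • M 1) := by
    have := toTorus_smul_add (r.den : ℤ) (-r.num) (M 0) (M 1)
    rw [show (((r.den : ℤ) : ℝ)) • M 0 + ((-r.num : ℤ) : ℝ) • M 1 =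
      (r.den : ℝ) • M 0 - (r.num : ℝ) • M 1 by push_cast; module] at this
    rw [this]; module
  rw [e, neg_ne_zero, Ne, Ne, toTorus_eq_zero_iff, toTorus_eq_zero_iff]; rfl

lemma toTorus_slMul (V : Matrix.SpecialLinearGroup (Fin 2) ℤ) (M : Matrix (Fin 2) (Fin 2) ℝ)
    (i : Fin 2) : toTorus (slMul V M i) = V i 0 • toTorus (M 0) + V i 1 • toTorus (M 1) := by
  rw [← toTorus_smul_add]
  congr 1
  ext j
  simp [slMul, Matrix.mul_apply, Fin.sum_univ_two]

lemma autFactor_eq {K : Type*} [Field K] [CharZero K]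
    (V : Matrix.SpecialLinearGroup (Fin 2) ℤ) (r : ℚ) :
    autFactor V (r : K) = ((V 1 0 * r.num + V 1 1 * r.den : ℤ) : K) / (r.den : K) := by
  have h : (r.den : K) ≠ 0 := by exact_mod_cast r.den_nz
  have hr : (r : K) = r.num / r.den := by rw [Rat.cast_def]
  rw [autFactor, hr]; push_cast; field_simp

lemma fracLin_eq (V : Matrix.SpecialLinearGroup (Fin 2) ℤ) (r : ℚ) :
    fracLin V r = ((V 0 0 * r.num + V 0 1 * r.den : ℤ) : ℚ) /
      ((V 1 0 * r.num + V 1 1 * r.den : ℤ) : ℚ) := by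
  have h : (r.den : ℚ) ≠ 0 := by exact_mod_cast r.den_nz
  have h1 := autFactor_eq (K := ℚ) V r
  rw [Rat.cast_id] at h1
  rw [fracLin, h1]
  have : (V 0 0 : ℚ) * r + V 0 1 = ((V 0 0 * r.num + V 0 1 * r.den : ℤ) : ℚ) / r.den := by
    conv_lhs => rw [← Rat.num_div_den r]
    push_cast; field_simp
  rw [this, div_div_div_cancel_right₀ h]

lemma isCoprime_fracLin (V : Matrix.SpecialLinearGroup (Fin 2) ℤ) (r : ℚ) :
    IsCoprime (V 0 0 * r.num + V 0 1 * r.den) (V 1 0 * r.num + V 1 1 * r.den) := by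
  obtain ⟨u, v, h⟩ : IsCoprime r.num (r.den : ℤ) :=
    Int.isCoprime_iff_nat_coprime.2 (by simpa using r.reduced)
  have hd := det_entries V
  exact ⟨u * V 1 1 - v * V 1 0, v * V 0 0 - u * V 0 1, by
    linear_combination (u * r.num + v * r.den) * hd + h⟩

/-- The period sum in terms of the coefficients `β_m`: the binomial coefficients cancel against the
factorials, and parity turns `d t + x` into `-x - d t`, as in `torus_relation`. -/
lemma periodSumPos_eq {τ : ℂ} (hτ : 0 < τ.im) {V : Matrix.SpecialLinearGroup (Fin 2) ℤ}
    (hc : 0 < V 1 0) {M : Matrix (Fin 2) (Fin 2) ℝ} (hM : M ∈ matSetSL V) (l : ℕ) (z : ℂ) :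
    periodSumPos V l z M τ = ∑ e ∈ Finset.HasAntidiagonal.antidiagonal (l + 1),
      (-autFactor V z) ^ ((e.1 : ℤ) - 1) * (-1) ^ e.2 * (1 / (V 1 0 : ℂ) *
        ∑ t ∈ divisionPoints (V 1 0) (toTorus (M 1)),
          torusCoeff τ e.2 (-toTorus (M 0) - V 1 1 • t) * torusCoeff τ e.1 t) := by
  obtain ⟨hy, hY⟩ := mem_matSetSL_iff.1 hM
  have hcop := Int.isCoprime_iff_nat_coprime.1 (isCoprime_bottom_row V)
  have hnum := Rat.num_div_eq_of_coprime hc hcop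
  have hden := Rat.den_div_eq_of_coprime hc hcop
  have hdenC : (((V 1 1 : ℚ) / (V 1 0 : ℚ)).den : ℂ) = V 1 0 := by exact_mod_cast hden
  set N : Matrix (Fin 2) (Fin 2) ℝ := Matrix.of ![fun i => -M 0 i, M 1] with hN
  have e1 : toTorus (N 1) = toTorus (M 1) := rfl
  have e0 : toTorus (N 0) = -toTorus (M 0) := toTorus_neg _
  have hpi := Complex.two_pi_I_ne_zero
  rw [periodSumPos, ← hN, Finset.mul_sum]
  refine Finset.sum_congr rfl fun e he => ?_
  rw [Finset.HasAntidiagonal.mem_antidiagonal] at he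
  rw [dedekindRademacher_eq hτ (by rwa [e1]) (by
    rw [e1, e0, hnum, hden]
    intro h; exact hY (by rw [← h]; module)), e1, e0, hnum, hden, hdenC, he]
  have hsum : ∑ t ∈ divisionPoints (V 1 0) (toTorus (M 1)),
      torusCoeff τ e.1 t * torusCoeff τ e.2 (V 1 1 • t - -toTorus (M 0)) =
      (-1) ^ e.2 * ∑ t ∈ divisionPoints (V 1 0) (toTorus (M 1)),
        torusCoeff τ e.2 (-toTorus (M 0) - V 1 1 • t) * torusCoeff τ e.1 t := by
    rw [Finset.mul_sum]
    refine Finset.sum_congr rfl fun t ht => ?_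
    rw [mem_divisionPoints hc.ne'] at ht
    rw [show V 1 1 • t - -toTorus (M 0) = -(-toTorus (M 0) - V 1 1 • t) by module,
      torusCoeff_neg hτ]
    · ring
    · intro h
      refine hY ?_
      have h' : toTorus (M 0) = -(V 1 1 • t) := by
        rw [sub_eq_zero] at h; rw [← h, neg_neg]
      rw [h', ← ht]; module
  have hchoose : ((l + 1).choose e.1 : ℂ) * (e.1.factorial * e.2.factorial) =
      (l + 1).factorial := by
    have := Nat.add_choose_mul_factorial_mul_factorial e.1 e.2
    rw [he, ← Nat.choose_symm_of_eq_add he.symm] at this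
    rw [← mul_assoc]; exact_mod_cast this
  have hf : ((l + 1).factorial : ℂ) ≠ 0 := by exact_mod_cast (l + 1).factorial_ne_zero
  rw [hsum, ← hchoose]
  rw [← hchoose] at hf
  generalize (∑ t ∈ divisionPoints (V 1 0) (toTorus (M 1)),
        torusCoeff τ e.2 (-toTorus (M 0) - V 1 1 • t) * torusCoeff τ e.1 t) = W
  generalize (-autFactor V z) ^ ((e.1 : ℤ) - 1) = A
  have h1 := left_ne_zero_of_mul hf
  have h2 := right_ne_zero_of_mul hf
  have h3 := left_ne_zero_of_mul h2
  have h4 := right_ne_zero_of_mul h2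
  field_simp

/-- The transformation law when the lower left entry of `V` is positive, with `l = k + 1`. -/
theorem dedekindRademacher_transform_of_pos {r : ℚ} {k : ℕ} {τ : ℂ}
    {V : Matrix.SpecialLinearGroup (Fin 2) ℤ} {M : Matrix (Fin 2) (Fin 2) ℝ} (hτ : 0 < τ.im)
    (hc : 0 < V 1 0) (hj : autFactor V r ≠ 0) (hMV : M ∈ matSetSL V) (hMr : M ∈ matSetRat r) :
    dedekindRademacher 1 (k + 1) r M τ -
        autFactor V (r : ℂ) ^ k * dedekindRademacher 1 (k + 1) (fracLin V r) (slMul V M) τ =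
      (-1) ^ (k + 1) * ((k + 1).factorial : ℂ) / (2 * Real.pi * I) ^ (k + 2) *
          periodSumPos V (k + 1) r M τ -
        (-1) ^ (k + 1) * ((k + 1 : ℕ) : ℂ) / (((k + 1 : ℕ) : ℂ) + 1) *
          ((V 1 0 : ℂ) / autFactor V (r : ℂ)) *
          (ellipticBernoulli (k + 2) (fun i => (r.den : ℝ) * M 0 i - (r.num : ℝ) * M 1 i) τ /
            (r.den : ℂ) ^ (k + 2)) := by
  obtain ⟨hy, hY⟩ := mem_matSetSL_iff.1 hMV
  obtain ⟨-, hA⟩ := mem_matSetRat_iff.1 hMr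
  have hq : (r.den : ℤ) ≠ 0 := by exact_mod_cast r.den_nz
  have hqC : (r.den : ℂ) ≠ 0 := by exact_mod_cast r.den_nz
  have hcC : (V 1 0 : ℂ) ≠ 0 := by exact_mod_cast hc.ne'
  have hQ : V 1 0 * r.num + V 1 1 * r.den ≠ 0 := by
    intro h
    have := autFactor_eq (K := ℚ) V r
    rw [Rat.cast_id] at this
    rw [this, h] at hj
    simp at hj
  have hpq : IsCoprime r.num (r.den : ℤ) :=
    Int.isCoprime_iff_nat_coprime.2 (by simpa using r.reduced)
  have hdet : V 0 0 * V 1 1 - V 0 1 * V 1 0 = 1 := det_entries V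
  have hrel := torus_relation hτ hdet hpq hq hc.ne' hQ hy hY hA (k + 1)
  -- the three kinds of terms, in terms of sums over division points
  have hS1 := dedekindRademacher_one_eq hτ hq hpq hy hA (k + 1)
  have hr : ((r.num : ℚ) / ((r.den : ℤ) : ℚ)) = r := by
    rw [Int.cast_natCast]; exact Rat.num_div_den r
  rw [hr] at hS1
  have hA' : (V 0 0 * r.num + V 0 1 * r.den) • toTorus (slMul V M 1) -
      (V 1 0 * r.num + V 1 1 * r.den) • toTorus (slMul V M 0) ≠ 0 := by
    rw [toTorus_slMul, toTorus_slMul]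
    intro h
    refine hA ?_
    have e : (V 0 0 * r.num + V 0 1 * r.den) • (V 1 0 • toTorus (M 0) + V 1 1 • toTorus (M 1)) -
        (V 1 0 * r.num + V 1 1 * r.den) • (V 0 0 • toTorus (M 0) + V 0 1 • toTorus (M 1)) =
        (V 0 0 * V 1 1 - V 0 1 * V 1 0) •
          (r.num • toTorus (M 1) - (r.den : ℤ) • toTorus (M 0)) := by module
    rw [e, hdet, one_smul] at h
    exact h
  have hS2 := dedekindRademacher_one_eq hτ hQ (isCoprime_fracLin V r)
    (M := slMul V M) (by rw [toTorus_slMul]; exact hY) hA' (k + 1)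
  rw [← fracLin_eq, toTorus_slMul, toTorus_slMul] at hS2
  have hB : ellipticBernoulli (k + 2) (fun i => (r.den : ℝ) * M 0 i - (r.num : ℝ) * M 1 i) τ =
      (k + 2).factorial / (2 * Real.pi * I) ^ (k + 2) * ((-1) ^ (k + 2) *
        torusCoeff τ (k + 2) (r.num • toTorus (M 1) - (r.den : ℤ) • toTorus (M 0))) := by
    rw [ellipticBernoulli_eq, ← torusCoeff_neg hτ hA]
    congr 1
    have e : -(r.num • toTorus (M 1) - (r.den : ℤ) • toTorus (M 0)) =
        toTorus fun i => (r.den : ℝ) * M 0 i - (r.num : ℝ) * M 1 i := by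
      rw [neg_sub, zsmul_toTorus, zsmul_toTorus, sub_eq_add_neg, ← toTorus_neg, ← toTorus_add]
      rfl
    have h0 := neg_ne_zero.2 hA
    rw [e, Ne, toTorus_eq_zero_iff] at h0
    rw [e, torusCoeff_toTorus hτ h0]
  have hR := periodSumPos_eq hτ hc hMV (k + 1) r
  set c : ℤ := V 1 0 with hcdef
  set Q : ℤ := c * r.num + V 1 1 * r.den with hQdef
  have hQC : (Q : ℂ) ≠ 0 := by exact_mod_cast hQ
  have hjC : autFactor V (r : ℂ) = (Q : ℂ) / r.den := autFactor_eq V r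
  -- the left-hand side of the torus relation is a multiple of the period sum
  have hlhs : ∑ e ∈ Finset.HasAntidiagonal.antidiagonal (k + 1 + 1),
        (Q : ℂ) ^ (2 - e.1 : ℤ) * (((r.den : ℤ) : ℂ)) ^ (2 - e.2 : ℤ) *
          ∑ t ∈ divisionPoints c (toTorus (M 1)),
            torusCoeff τ e.1 (-toTorus (M 0) - V 1 1 • t) * torusCoeff τ e.2 t =
      (-1) ^ (k + 1) * (Q / Q ^ k) * r.den * c * periodSumPos V (k + 1) r M τ := by
    rw [← Finset.Nat.sum_antidiagonal_swap, hR, Finset.mul_sum]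
    refine Finset.sum_congr rfl fun e he => ?_
    rw [Finset.HasAntidiagonal.mem_antidiagonal] at he
    simp only [Prod.fst_swap, Prod.snd_swap]
    have hcoef : (Q : ℂ) ^ (2 - e.2 : ℤ) * (((r.den : ℤ) : ℂ)) ^ (2 - e.1 : ℤ) =
        (-1) ^ (k + 1) * (Q / Q ^ k) * r.den *
          ((-autFactor V (r : ℂ)) ^ ((e.1 : ℤ) - 1) * (-1) ^ e.2) := by
      rw [hjC, Int.cast_natCast, neg_eq_neg_one_mul ((Q : ℂ) / r.den), mul_zpow, div_zpow]
      have hs : (-1 : ℂ) ^ (k + 1) * ((-1) ^ ((e.1 : ℤ) - 1) * (-1) ^ e.2) = 1 := by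
        rw [← zpow_natCast, ← zpow_natCast, ← zpow_add₀ (by norm_num), ← zpow_add₀ (by norm_num),
          show ((k + 1 : ℕ) : ℤ) + ((e.1 : ℤ) - 1 + (e.2 : ℤ)) = 2 * (k + 1) by
            push_cast; omega, zpow_mul]
        norm_num
      have h1 : (Q : ℂ) ^ (2 - e.2 : ℤ) = Q / Q ^ k * Q ^ ((e.1 : ℤ) - 1) := by
        rw [show (2 - e.2 : ℤ) = 1 - k + ((e.1 : ℤ) - 1) by omega, zpow_add₀ hQC,
          zpow_sub₀ hQC, zpow_one, zpow_natCast]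
      have h2 : (r.den : ℂ) ^ (2 - e.1 : ℤ) = r.den / r.den ^ ((e.1 : ℤ) - 1) := by
        rw [show (2 - e.1 : ℤ) = 1 - ((e.1 : ℤ) - 1) by omega, zpow_sub₀ hqC, zpow_one]
      rw [h1, h2]
      linear_combination (-(Q / Q ^ k * Q ^ ((e.1 : ℤ) - 1) * (r.den / r.den ^ ((e.1 : ℤ) - 1)) :
        ℂ)) * hs
    rw [hcoef]
    field_simp
  rw [hlhs] at hrel
  have hQ1 : (Q : ℂ) ^ (2 - ((k + 1 : ℕ) : ℤ) : ℤ) = Q / Q ^ k := by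
    rw [show (2 - ((k + 1 : ℕ) : ℤ)) = 1 - k by push_cast; ring, zpow_sub₀ hQC, zpow_one,
      zpow_natCast]
  have hQ2 : (Q : ℂ) ^ (1 - ((k + 1 : ℕ) : ℤ) : ℤ) = 1 / Q ^ k := by
    rw [show (1 - ((k + 1 : ℕ) : ℤ)) = -k by push_cast; ring, zpow_neg, zpow_natCast, one_div]
  have hq1 : (r.den : ℂ) ^ (2 - ((k + 1 : ℕ) : ℤ) : ℤ) = r.den / r.den ^ k := by
    rw [show (2 - ((k + 1 : ℕ) : ℤ)) = 1 - k by push_cast; ring, zpow_sub₀ hqC, zpow_one,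
      zpow_natCast]
  have hq2 : (r.den : ℂ) ^ (1 - ((k + 1 : ℕ) : ℤ) : ℤ) = 1 / r.den ^ k := by
    rw [show (1 - ((k + 1 : ℕ) : ℤ)) = -k by push_cast; ring, zpow_neg, zpow_natCast, one_div]
  simp only [Int.cast_natCast] at hrel hS1
  rw [hQ1, hQ2, hq1, hq2] at hrel
  rw [hS1, hS2, hB, hjC, show ((k + 2).factorial : ℂ) = (k + 2) * (k + 1).factorial by
    rw [Nat.factorial_succ]; push_cast; ring]
  generalize (∑ t ∈ divisionPoints (r.den : ℤ) (toTorus (M 1)), torusCoeff τ 1 t *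
    torusCoeff τ (k + 1) (r.num • t - toTorus (M 0))) = T1 at hrel ⊢
  generalize (∑ t ∈ divisionPoints Q (c • toTorus (M 0) + V 1 1 • toTorus (M 1)),
    torusCoeff τ 1 t * torusCoeff τ (k + 1) ((V 0 0 * r.num + V 0 1 * r.den) • t -
      (V 0 0 • toTorus (M 0) + V 0 1 • toTorus (M 1)))) = T2 at hrel ⊢
  change _ = _ - _ - _ * torusCoeff τ (k + 2) _ at hrel
  generalize torusCoeff τ (k + 2)
    (r.num • toTorus (M 1) - (r.den : ℤ) • toTorus (M 0)) = B at hrel ⊢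
  generalize periodSumPos V (k + 1) r M τ = R at hrel ⊢
  have hs : (-1 : ℂ) ^ (k + 1) * (-1) ^ (k + 2) = -1 := by
    rw [← pow_add, show k + 1 + (k + 2) = 2 * (k + 1) + 1 by ring, pow_succ, pow_mul]; norm_num
  have hk2 : ((k : ℂ) + 2) ≠ 0 := by exact_mod_cast (k + 1).succ_ne_zero
  have hk2' : (((k + 1 : ℕ) : ℂ) + 1) = k + 2 := by push_cast; ring
  have hpi := pow_ne_zero (k + 2) Complex.two_pi_I_ne_zero
  have hrel' : 1 / (r.den : ℂ) * T1 - (Q / r.den) ^ k * (1 / Q * T2) =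
      (-1) ^ (k + 1) * R + (k + 1 : ℕ) * (c / (Q / r.den)) * (B / r.den ^ (k + 2)) := by
    have h := congrArg (fun w : ℂ => w * (Q ^ k / (Q * r.den * c))) hrel
    have e1 : (-1 : ℂ) ^ (k + 1) * (Q / Q ^ k) * r.den * c * R * (Q ^ k / (Q * r.den * c)) =
        (-1) ^ (k + 1) * R := by field_simp
    rw [e1] at h
    rw [h, div_pow]
    field_simp
    ring
  rw [hk2']
  generalize (2 * (Real.pi : ℂ) * I) ^ (k + 2) = K at hpi ⊢
  have e2 : (-1 : ℂ) ^ (k + 1) * ((k + 1 : ℕ) : ℂ) / (k + 2) * (c / (Q / r.den)) *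
      ((k + 2) * ((k + 1).factorial : ℂ) / K * ((-1) ^ (k + 2) * B) / r.den ^ (k + 2)) =
      -(((k + 1).factorial : ℂ) / K * ((k + 1 : ℕ) * (c / (Q / r.den)) *
        (B / r.den ^ (k + 2)))) := by
    field_simp
    linear_combination ((k + 1).factorial : ℂ) * B * hs
  rw [e2]
  linear_combination ((k + 1).factorial : ℂ) / K * hrel'

lemma autFactor_neg {K : Type*} [Field K] (V : Matrix.SpecialLinearGroup (Fin 2) ℤ) (z : K) :
    autFactor (-V) z = -autFactor V z := by
  simp only [autFactor, Matrix.SpecialLinearGroup.coe_neg, Matrix.neg_apply, Int.cast_neg]; ring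

lemma fracLin_neg {K : Type*} [Field K] (V : Matrix.SpecialLinearGroup (Fin 2) ℤ) (z : K) :
    fracLin (-V) z = fracLin V z := by
  rw [fracLin, autFactor_neg, fracLin]
  simp only [Matrix.SpecialLinearGroup.coe_neg, Matrix.neg_apply, Int.cast_neg]
  rw [← neg_div_neg_eq, neg_neg]; congr 1; ring

lemma slMul_neg (V : Matrix.SpecialLinearGroup (Fin 2) ℤ) (M : Matrix (Fin 2) (Fin 2) ℝ) :
    slMul (-V) M = -slMul V M := by
  ext i j
  simp only [slMul, Matrix.SpecialLinearGroup.coe_neg, Matrix.mul_apply, Matrix.map_apply,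
    Matrix.neg_apply, Int.cast_neg, Fin.sum_univ_two]
  ring

lemma matSetSL_neg (V : Matrix.SpecialLinearGroup (Fin 2) ℤ) : matSetSL (-V) = matSetSL V := by
  ext M
  rw [mem_matSetSL_iff, mem_matSetSL_iff]
  refine and_congr_right fun _ => ?_
  rw [← neg_ne_zero (a := V 1 0 • toTorus (M 0) + _)]
  simp only [Matrix.SpecialLinearGroup.coe_neg, Matrix.neg_apply]
  rw [show -V 1 0 • toTorus (M 0) + -V 1 1 • toTorus (M 1) =
    -(V 1 0 • toTorus (M 0) + V 1 1 • toTorus (M 1)) by module]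

/-- The pair `(Vr, VM)` satisfies the condition under which its sum is defined. -/
lemma slMul_mem_matSetRat {r : ℚ} {V : Matrix.SpecialLinearGroup (Fin 2) ℤ}
    {M : Matrix (Fin 2) (Fin 2) ℝ} (hj : autFactor V r ≠ 0) (hMV : M ∈ matSetSL V)
    (hMr : M ∈ matSetRat r) : slMul V M ∈ matSetRat (fracLin V r) := by
  have hQ : V 1 0 * r.num + V 1 1 * r.den ≠ 0 := by
    intro h
    have := autFactor_eq (K := ℚ) V r
    rw [Rat.cast_id] at this
    rw [this, h] at hj
    simp at hj
  obtain ⟨-, hY⟩ := mem_matSetSL_iff.1 hMV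
  obtain ⟨-, hA⟩ := mem_matSetRat_iff.1 hMr
  obtain ⟨ε, hε, hnum, hden⟩ := exists_num_den_eq hQ (isCoprime_fracLin V r)
  rw [mem_matSetRat_iff, toTorus_slMul, toTorus_slMul, fracLin_eq, hnum, hden]
  refine ⟨hY, fun h => hA ?_⟩
  have e : (ε * (V 0 0 * r.num + V 0 1 * r.den)) •
        (V 1 0 • toTorus (M 0) + V 1 1 • toTorus (M 1)) -
      (ε * (V 1 0 * r.num + V 1 1 * r.den)) •
        (V 0 0 • toTorus (M 0) + V 0 1 • toTorus (M 1)) =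
      (V 0 0 * V 1 1 - V 0 1 * V 1 0) • ε •
        (r.num • toTorus (M 1) - (r.den : ℤ) • toTorus (M 0)) := by module
  rw [e, det_entries, one_smul] at h
  rcases hε with rfl | rfl
  · simpa using h
  · rw [← neg_eq_zero, ← h]; module

/-- If the lower left entry of `V` is zero then `V` acts on `r` by an integral translation, and
the two Dedekind–Rademacher sums agree term by term. -/
lemma dedekindRademacher_translate {r : ℚ} {k : ℕ} {τ : ℂ}
    {V : Matrix.SpecialLinearGroup (Fin 2) ℤ} {M : Matrix (Fin 2) (Fin 2) ℝ} (hτ : 0 < τ.im)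
    (hc : V 1 0 = 0) (hMr : M ∈ matSetRat r) :
    autFactor V (r : ℂ) ^ k * dedekindRademacher 1 (k + 1) (fracLin V r) (slMul V M) τ =
      dedekindRademacher 1 (k + 1) r M τ := by
  obtain ⟨hy, hA⟩ := mem_matSetRat_iff.1 hMr
  have hq : (r.den : ℤ) ≠ 0 := by exact_mod_cast r.den_nz
  have hqC : (r.den : ℂ) ≠ 0 := by exact_mod_cast r.den_nz
  have hpq : IsCoprime r.num (r.den : ℤ) :=
    Int.isCoprime_iff_nat_coprime.2 (by simpa using r.reduced)
  have hS1 := dedekindRademacher_one_eq hτ hq hpq hy hA (k + 1)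
  have hr : ((r.num : ℚ) / ((r.den : ℤ) : ℚ)) = r := by
    rw [Int.cast_natCast]; exact Rat.num_div_den r
  rw [hr] at hS1
  have hdet := det_entries V
  rw [hc, mul_zero, sub_zero] at hdet
  have hd : V 1 1 = 1 ∨ V 1 1 = -1 := Int.isUnit_iff.1 (IsUnit.of_mul_eq_one _ (by
    rw [mul_comm]; exact hdet))
  have ha : V 0 0 = V 1 1 := by rcases hd with h | h <;> rw [h] at hdet ⊢ <;> omega
  have hdd : V 1 1 * V 1 1 = 1 := by rw [ha] at hdet; exact hdet
  have hcop := isCoprime_fracLin V r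
  have hfrac := fracLin_eq V r
  have hY : toTorus (slMul V M 1) = V 1 1 • toTorus (M 1) := by
    rw [toTorus_slMul, hc, zero_smul, zero_add]
  have hX : toTorus (slMul V M 0) = V 1 1 • toTorus (M 0) + V 0 1 • toTorus (M 1) := by
    rw [toTorus_slMul, ha]
  rw [hc, zero_mul, zero_add] at hcop hfrac
  rw [ha] at hcop hfrac
  have hj : autFactor V (r : ℂ) = V 1 1 := by simp [autFactor, hc]
  set d : ℤ := V 1 1 with hddef
  have hd0 : d ≠ 0 := by rintro h; rw [h] at hdd; simp at hdd
  have hdq : d * r.den ≠ 0 := mul_ne_zero hd0 hq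
  have hS2 := dedekindRademacher_one_eq hτ hdq hcop (M := slMul V M)
    (by
      rw [hY]; intro h; refine hy ?_
      rw [← one_smul ℤ (toTorus (M 1)), ← hdd, mul_smul, h, smul_zero])
    (by
      rw [hY, hX]; intro h; refine hA ?_
      have e : (d * r.num + V 0 1 * r.den) • d • toTorus (M 1) -
          (d * (r.den : ℤ)) • (d • toTorus (M 0) + V 0 1 • toTorus (M 1)) =
          (d * d) • (r.num • toTorus (M 1) - (r.den : ℤ) • toTorus (M 0)) := by module
      rw [e, hdd, one_smul] at h
      exact h) (k + 1)
  rw [← hfrac] at hS2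
  have hdiv : divisionPoints (d * r.den) (toTorus (slMul V M 1)) =
      divisionPoints r.den (toTorus (M 1)) := by
    ext t
    rw [mem_divisionPoints hdq, mem_divisionPoints hq, hY, mul_smul]
    refine ⟨fun h => ?_, fun h => by rw [h]⟩
    rw [← one_smul ℤ ((r.den : ℤ) • t), ← hdd, mul_smul, h, ← mul_smul, hdd, one_smul]
  have hterm : ∀ t ∈ divisionPoints r.den (toTorus (M 1)),
      torusCoeff τ 1 t * torusCoeff τ (k + 1)
        ((d * r.num + V 0 1 * r.den) • t - toTorus (slMul V M 0)) =
      (d : ℂ) ^ (k + 1) *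
        (torusCoeff τ 1 t * torusCoeff τ (k + 1) (r.num • t - toTorus (M 0))) := by
    intro t ht
    rw [mem_divisionPoints hq] at ht
    have hu : r.num • t - toTorus (M 0) ≠ 0 := fun h => hA (by
      rw [sub_eq_zero] at h
      rw [← h, ← ht]; module)
    have e : (d * r.num + V 0 1 * r.den) • t - toTorus (slMul V M 0) =
        d • (r.num • t - toTorus (M 0)) := by
      rw [hX, ← ht]; module
    rw [e]
    rcases hd with h | h
    · rw [h]; simp
    · rw [h, neg_one_smul, torusCoeff_neg hτ hu]; push_cast; ring
  rw [hS1, hS2, hdiv, Finset.sum_congr rfl hterm, ← Finset.mul_sum, hj]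
  have hddC : (d : ℂ) * d = 1 := by exact_mod_cast hdd
  have hdC : (d : ℂ) ≠ 0 := by exact_mod_cast hd0
  have hpow : (d : ℂ) ^ k * d ^ k = 1 := by rw [← mul_pow, hddC, one_pow]
  push_cast
  rw [pow_succ (d : ℂ) k]
  generalize (∑ t ∈ divisionPoints (r.den : ℤ) (toTorus (M 1)), torusCoeff τ 1 t *
    torusCoeff τ (k + 1) (r.num • t - toTorus (M 0))) = T
  generalize (2 * (Real.pi : ℂ) * I) ^ (k + 1 + 1) = K
  have e : 1 / ((d : ℂ) * r.den) * (d ^ k * d * T) = d ^ k * (1 / r.den * T) := by field_simp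
  rw [e]
  linear_combination (((k + 1).factorial : ℂ) / K * (1 / r.den * T)) * hpow

theorem mainTheorem2 :
    (∀ V : Matrix.SpecialLinearGroup (Fin 2) ℤ, V 1 0 ≠ 0 →
      matSetRat (-(V 1 1 : ℚ) / (V 1 0 : ℚ)) = matSetSL V) ∧
    (∀ (r : ℚ) (l : ℕ) (τ : ℂ) (V : Matrix.SpecialLinearGroup (Fin 2) ℤ)
      (M : Matrix (Fin 2) (Fin 2) ℝ),
      0 < l → 0 < τ.im → autFactor V r ≠ 0 → M ∈ matSetSL V ∩ matSetRat r →
      dedekindRademacher 1 l r M τ -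
          autFactor V (r : ℂ) ^ (l - 1) *
            dedekindRademacher 1 l (fracLin V r) (slMul V M) τ =
        (-1) ^ l * (l.factorial : ℂ) / (2 * Real.pi * Complex.I) ^ (l + 1) *
            periodR V l (r : ℂ) M τ -
          (-1) ^ l * (l : ℂ) / ((l : ℂ) + 1) * ((V 1 0 : ℂ) / autFactor V (r : ℂ)) *
            (ellipticBernoulli (l + 1)
                (fun i => (r.den : ℝ) * M 0 i - (r.num : ℝ) * M 1 i) τ /
              (r.den : ℂ) ^ (l + 1))) := by
  refine ⟨matSetRat_eq_matSetSL, ?_⟩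
  rintro r l τ V M hl hτ hj ⟨hMV, hMr⟩
  obtain ⟨k, rfl⟩ : ∃ k, l = k + 1 := ⟨l - 1, by omega⟩
  rw [Nat.add_sub_cancel]
  rcases lt_trichotomy (V 1 0) 0 with hc | hc | hc
  · -- replacing `V` by `-V` changes neither side
    have hc' : 0 < (-V) 1 0 := by
      simp only [Matrix.SpecialLinearGroup.coe_neg, Matrix.neg_apply]; omega
    have h := dedekindRademacher_transform_of_pos (k := k) hτ hc'
      (by rwa [autFactor_neg, neg_ne_zero]) (by rwa [matSetSL_neg]) hMr
    obtain ⟨h1, h2⟩ := mem_matSetRat_iff.1 (slMul_mem_matSetRat hj hMV hMr)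
    have hneg : ((-V) 1 0 : ℂ) / autFactor (-V) (r : ℂ) = (V 1 0 : ℂ) / autFactor V (r : ℂ) := by
      rw [autFactor_neg]
      simp only [Matrix.SpecialLinearGroup.coe_neg, Matrix.neg_apply, Int.cast_neg]
      rw [neg_div_neg_eq]
    rw [hneg, autFactor_neg, fracLin_neg, slMul_neg, dedekindRademacher_neg hτ h1 h2] at h
    have hs : (-autFactor V (r : ℂ)) ^ k * ((-1) ^ (1 + (k + 1)) *
        dedekindRademacher 1 (k + 1) (fracLin V r) (slMul V M) τ) = autFactor V (r : ℂ) ^ k *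
        dedekindRademacher 1 (k + 1) (fracLin V r) (slMul V M) τ := by
      have : (-1 : ℂ) ^ k * (-1) ^ k = 1 := by rw [← mul_pow]; norm_num
      rw [neg_pow, pow_add, pow_succ]
      linear_combination (autFactor V (r : ℂ) ^ k *
        dedekindRademacher 1 (k + 1) (fracLin V r) (slMul V M) τ) * this
    rw [hs] at h
    rw [periodR, if_neg (by omega), if_neg hc.ne]
    exact h
  · rw [periodR, if_neg (by omega), if_pos hc, dedekindRademacher_translate hτ hc hMr, hc]
    simp
  · rw [periodR, if_pos hc]
    exact dedekindRademacher_transform_of_pos hτ hc hj hMV hMr
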